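/- Let $\lambda,\mu>0$ and $d\ge 0$. Consider the M/M/1/1 system: packets arrive with i.i.d. $\mathrm{Exp}(\lambda)$ inter-arrival times, starting at time $0$ with an idle server; there is no queue, a packet arriving while the server is busy is discarded, and otherwise its service starts immediately and is not interrupted; the service times $X_0,X_1,\dots$ of the served packets are i.i.d. $\mathrm{Exp}(\mu)$ and independent of the arrivals. Let $T_A(k)$ and $T_D(k)=T_A(k)+X_k$ be the arrival and departure instants of the $k$-th served packet, $k=0,1,2,\dots$. Let $\Delta(t)=t-\max\{T_A(n):T_D(n)\le t\}$ be the age of information at time $t$ (with $\Delta(t)=t$ before the first departure). For $k\ge 1$ let $g(k)$ be the total length of time in $[T_D(k-1),T_D(k))$ during which $\Delta>d$, and let $\nu=1/\mathbb{E}[T_D(k)-T_D(k-1)]$ be the expected departure rate. Then for every $k\ge 1$ the random variables $T_D(k)-T_D(k-1)$ and $g(k)$ are integrable, $$\frac1\nu=\frac1\lambda+\frac1\mu ,$$ $$\mathbb{E}[g(k)]=\begin{cases}\dfrac{\mu^2\left(e^{-\lambda d}-e^{-\mu d}\right)}{\lambda(\mu-\lambda)^2}+e^{-\mu d}\left(\dfrac1\lambda+\dfrac1\mu-\dfrac{\lambda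 d}{\mu-\lambda}\right), & \lambda\ne\mu,\\[2ex] \dfrac{\mu e^{-\mu d}}{2}\left(d+\dfrac2\mu\right)^2, & \lambda=\mu,\end{cases}$$ and the violation probability $\lim_{t\to\infty}\mathbb{P}(\Delta(t)>d)$, if this limit exists, equals $\nu\,\mathbb{E}[g(k)]$. Moreover, almost surely, the fraction of the time interval $[0,T]$ during which $\Delta>d$ converges to $\nu\,\mathbb{E}[g(k)]$ as $T\to\infty$. -/

import Mathlib

open MeasureTheory ProbabilityTheory Filter Topology

/-! Sample paths of a single-server system without a queue.  `z n` is the `n`-th inter-arrival time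
of the source (arrivals start after time `0`, with the server idle), and `x k` is the service time
of the `k`-th packet that is served.  Packets that find the server busy are discarded and receive no
index `k`.  Served packets are indexed by `k = 0, 1, 2, …`. -/

namespace AoI

/-- Time of the `n`-th arrival of the source, discarded arrivals included:
`z 0 + z 1 + ⋯ + z n`. -/
def sourceArrival (z : ℕ → ℝ) (n : ℕ) : ℝ := ∑ i ∈ Finset.range (n + 1), z i

/-- Index, among all arrivals of the source, of the `k`-th packet that is served: the very first
arrival for `k = 0`, and then the first later arrival that finds the server idle.  (The infimum is
over a nonempty set as soon as the arrival times are unbounded.) -/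
noncomputable def servedIndex (z x : ℕ → ℝ) : ℕ → ℕ
  | 0 => 0
  | k + 1 => sInf {n | servedIndex z x k < n ∧
      sourceArrival z (servedIndex z x k) + x k ≤ sourceArrival z n}

/-- `T_A(k)`: arrival instant of the `k`-th served packet. -/
noncomputable def arrivalTime (z x : ℕ → ℝ) (k : ℕ) : ℝ := sourceArrival z (servedIndex z x k)

/-- `T_D(k)`: departure instant of the `k`-th served packet; service starts upon arrival. -/
noncomputable def departureTime (z x : ℕ → ℝ) (k : ℕ) : ℝ := arrivalTime z x k + x k

/-- The age of information `Δ(t) = t - max {T_A(n) : T_D(n) ≤ t}`.  (Before the first departure the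
set is empty and this reads `Δ(t) = t`.) -/
noncomputable def age (z x : ℕ → ℝ) (t : ℝ) : ℝ :=
  t - sSup {a | ∃ n, departureTime z x n ≤ t ∧ arrivalTime z x n = a}

/-- `g(k)`, for `k ≥ 1`: the duration for which the age exceeds `d` between the departures of the
packets `k - 1` and `k`, that is, between two successive peaks of the age. -/
noncomputable def exceedanceTime (z x : ℕ → ℝ) (d : ℝ) (k : ℕ) : ℝ :=
  volume.real {t | t ∈ Set.Ico (departureTime z x (k - 1)) (departureTime z x k) ∧ d < age z x t}

/-- Fraction of the time interval `[0, T]` during which the age exceeds `d`. -/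
noncomputable def exceedanceFraction (z x : ℕ → ℝ) (d T : ℝ) : ℝ :=
  volume.real {t | t ∈ Set.Icc 0 T ∧ d < age z x t} / T

variable {Ω : Type*} [MeasurableSpace Ω]

/-- The M/M/1/1 input: inter-arrival times `Z n` with law `Exp(lam)` and service times `X k` with law
`Exp(mu)`, all of them jointly independent. -/
structure IsMM11 (P : Measure Ω) (Z X : ℕ → Ω → ℝ) (lam mu : ℝ) : Prop where
  measurable_interarrival : ∀ n, Measurable (Z n)
  measurable_service : ∀ k, Measurable (X k)
  map_interarrival : ∀ n, P.map (Z n) = expMeasure lam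
  map_service : ∀ k, P.map (X k) = expMeasure mu
  indep : iIndepFun (Sum.elim Z X) P

/-- Inter-departure time `T_D(k) - T_D(k-1)`, for `k ≥ 1`, as a random variable. -/
noncomputable def interDeparture (Z X : ℕ → Ω → ℝ) (k : ℕ) (ω : Ω) : ℝ :=
  departureTime (fun n => Z n ω) (fun n => X n ω) k -
    departureTime (fun n => Z n ω) (fun n => X n ω) (k - 1)

/-- The expected departure rate `ν = 1 / E[T_D(k) - T_D(k-1)]`. -/
noncomputable def departureRate (P : Measure Ω) (Z X : ℕ → Ω → ℝ) (k : ℕ) : ℝ :=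
  1 / ∫ ω, interDeparture Z X k ω ∂P

/-- `g(k)` as a random variable. -/
noncomputable def g (Z X : ℕ → Ω → ℝ) (d : ℝ) (k : ℕ) (ω : Ω) : ℝ :=
  exceedanceTime (fun n => Z n ω) (fun n => X n ω) d k

/-- `P(Δ(t) > d)`. -/
noncomputable def violationProb (P : Measure Ω) (Z X : ℕ → Ω → ℝ) (d t : ℝ) : ℝ :=
  P.real {ω | d < age (fun n => Z n ω) (fun n => X n ω) t}

end AoI

namespace AoI

open scoped ENNReal

/-! ### The exponential distribution -/

/-! Memorylessness turns the path-dependent system into a sequence of independent variables. When a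
service ends, the remaining wait for the next arrival is again `Exp(lam)`, and the gaps after it are
fresh (`measurePreserving_residual`). For a fixed service sequence the idle periods `I 0, I 1, …`
are therefore i.i.d. `Exp(lam)` (`measurePreserving_idle`). Their law does not depend on that
sequence, so they are independent of the services (`IsMM11.measurePreserving_idlePeriod`).

The time between departures `k` and `k + 1` is `I k + X (k + 1)`, with mean `1 / lam + 1 / mu`.
During this cycle the age starts at `X k` and grows with slope one, so it spends time `max 0 (I k +
X (k + 1) - max 0 (d - X k))` above `d` (`exceedanceTime_succ`). As `X k` is independent of the
cycle length, Tonelli gives the mean as the integral over `s > 0` of P(cycle length > `s`) · P(`X k`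
> `d - s`), which is evaluated explicitly (`lintegral_ofReal_exceedance`).

Adjacent cycles share a service time, but the even cycles are i.i.d. and so are the odd ones. Two
strong laws (`IsMM11.tendsto_average_of_cycles`) and a renewal-reward sandwich
(`tendsto_div_of_tendsto_subsequence`) give the almost sure limit of the exceedance fraction.

By Fubini the expected fraction is the time average of the violation probability, and by bounded
convergence it has the same limit as the fraction. If the violation probability converges, its time
average converges to the same value, which identifies its limit. -/

instance isProbabilityMeasure_exp (r : ℝ) [hr : Fact (0 < r)] :
    IsProbabilityMeasure (expMeasure r) := isProbabilityMeasure_expMeasure hr.out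

lemma lintegral_expMeasure (r : ℝ) {f : ℝ → ℝ≥0∞} (hf : Measurable f) :
    ∫⁻ u, f u ∂(expMeasure r) =
      ∫⁻ u, (Set.Ici 0).indicator (fun u => ENNReal.ofReal (r * Real.exp (-(r * u))) * f u) u := by
  change ∫⁻ u, f u ∂(volume.withDensity (exponentialPDF r)) = _
  have hm : Measurable (exponentialPDF r) :=
    (measurable_exponentialPDFReal r).ennreal_ofReal
  rw [lintegral_withDensity_eq_lintegral_mul _ hm hf]
  refine lintegral_congr fun u => ?_
  by_cases hu : 0 ≤ u
  · simp [exponentialPDF_eq, hu]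
  · simp [exponentialPDF_eq, hu]

/-- Memorylessness of the exponential distribution. -/
lemma lintegral_expMeasure_Ici_sub (r : ℝ) {x : ℝ} (hx : 0 ≤ x) {f : ℝ → ℝ≥0∞}
    (hf : Measurable f) :
    ∫⁻ u in Set.Ici x, f (u - x) ∂(expMeasure r) =
      ENNReal.ofReal (Real.exp (-(r * x))) * ∫⁻ u, f u ∂(expMeasure r) := by
  -- Translating the variable by `x` turns the density at `u + x` into `exp (-(r * x))` times the
  -- density at `u`.
  rw [← lintegral_indicator measurableSet_Ici, lintegral_expMeasure r hf,
    lintegral_expMeasure r (Measurable.indicator (by fun_prop) measurableSet_Ici),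
    ← lintegral_const_mul' _ _ ENNReal.ofReal_ne_top,
    ← lintegral_add_right_eq_self _ x]
  refine lintegral_congr fun u => ?_
  by_cases hu : 0 ≤ u
  · have h1 : 0 ≤ u + x := by positivity
    simp only [Set.indicator, Set.mem_Ici, hu, h1, if_true, le_add_iff_nonneg_left,
      add_sub_cancel_right]
    rw [← mul_assoc, ← ENNReal.ofReal_mul (Real.exp_pos _).le]
    congr 2
    rw [mul_left_comm, ← Real.exp_add]
    ring_nf
  · by_cases h1 : 0 ≤ u + x <;> simp [Set.indicator, hu, h1]

lemma expMeasure_Ici (r : ℝ) [Fact (0 < r)] {x : ℝ} (hx : 0 ≤ x) :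
    expMeasure r (Set.Ici x) = ENNReal.ofReal (Real.exp (-(r * x))) := by
  simpa using lintegral_expMeasure_Ici_sub r hx (f := fun _ => 1) measurable_const

instance nullSingletonClass_expMeasure (r : ℝ) : NullSingletonClass (expMeasure r) :=
  inferInstanceAs (NullSingletonClass (volume.withDensity (gammaPDF 1 r)))

lemma expMeasure_Ioi (r : ℝ) [Fact (0 < r)] {x : ℝ} (hx : 0 ≤ x) :
    expMeasure r (Set.Ioi x) = ENNReal.ofReal (Real.exp (-(r * x))) := by
  rw [← expMeasure_Ici r hx]
  exact measure_congr Ioi_ae_eq_Ici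

/-- The truncated exponent covers negative thresholds too; they occur below as `s - u` and `d - s`.
-/
lemma expMeasure_Ioi_max (r : ℝ) [Fact (0 < r)] (x : ℝ) :
    expMeasure r (Set.Ioi x) = ENNReal.ofReal (Real.exp (-(r * max x 0))) := by
  rcases le_total 0 x with hx | hx
  · rw [expMeasure_Ioi r hx, max_eq_left hx]
  · rw [max_eq_right hx]
    simp only [mul_zero, neg_zero, Real.exp_zero, ENNReal.ofReal_one]
    refine le_antisymm prob_le_one ?_
    calc (1 : ℝ≥0∞) = expMeasure r (Set.Ioi 0) := by simp [expMeasure_Ioi r le_rfl]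
      _ ≤ _ := measure_mono (Set.Ioi_subset_Ioi hx)

lemma ae_pos_expMeasure (r : ℝ) [Fact (0 < r)] : ∀ᵐ u ∂(expMeasure r), 0 < u := by
  have h : expMeasure r (Set.Ioi 0) = 1 := by simp [expMeasure_Ioi r le_rfl]
  exact (mem_ae_iff_prob_eq_one measurableSet_Ioi).2 h

lemma integrableOn_exp_neg_mul {r : ℝ} (hr : 0 < r) (a : ℝ) :
    IntegrableOn (fun s => Real.exp (-(r * s))) (Set.Ioi a) := by
  simpa using integrableOn_exp_mul_Ioi (neg_neg_of_pos hr) a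

lemma lintegral_ofReal_expMeasure (r : ℝ) [hr : Fact (0 < r)] :
    ∫⁻ u, ENNReal.ofReal u ∂(expMeasure r) = ENNReal.ofReal (1 / r) := by
  rw [lintegral_eq_lintegral_meas_lt (f := fun u => u) (expMeasure r)
    ((ae_pos_expMeasure r).mono fun u hu => hu.le) aemeasurable_id]
  have : ∀ t ∈ Set.Ioi (0 : ℝ), expMeasure r {a | t < a} =
      ENNReal.ofReal (Real.exp (-(r * t))) := fun t ht => expMeasure_Ioi r (le_of_lt ht)
  rw [setLIntegral_congr_fun measurableSet_Ioi this,
    ← ofReal_integral_eq_lintegral_ofReal (integrableOn_exp_neg_mul hr.out 0)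
      (ae_of_all _ fun _ => (Real.exp_pos _).le)]
  congr 1
  have := integral_exp_mul_Ioi (neg_neg_of_pos hr.out) 0
  simp only [neg_mul] at this
  rw [this]
  simp

lemma integrable_id_expMeasure (r : ℝ) [hr : Fact (0 < r)] :
    Integrable (fun u => u) (expMeasure r) := by
  refine ⟨aestronglyMeasurable_id, ?_⟩
  rw [hasFiniteIntegral_iff_ofReal ((ae_pos_expMeasure r).mono fun u hu => hu.le),
    lintegral_ofReal_expMeasure]
  exact ENNReal.ofReal_lt_top

lemma integral_id_expMeasure (r : ℝ) [hr : Fact (0 < r)] : ∫ u, u ∂(expMeasure r) = 1 / r := by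
  rw [integral_eq_lintegral_of_nonneg_ae ((ae_pos_expMeasure r).mono fun u hu => hu.le)
    aestronglyMeasurable_id, lintegral_ofReal_expMeasure,
    ENNReal.toReal_ofReal (one_div_pos.2 hr.out).le]

/-! ### Splitting product measures -/

/-- The sequence with its first term dropped. -/
def tail (z : ℕ → ℝ) : ℕ → ℝ := fun j => z (j + 1)

/-- The sequence with one term added in front. -/
def cons (a : ℝ) (z : ℕ → ℝ) : ℕ → ℝ
  | 0 => a
  | j + 1 => z j

@[simp] lemma cons_zero (a : ℝ) (z : ℕ → ℝ) : cons a z 0 = a := rfl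

@[simp] lemma cons_succ (a : ℝ) (z : ℕ → ℝ) (j : ℕ) : cons a z (j + 1) = z j := rfl

@[simp] lemma tail_cons (a : ℝ) (z : ℕ → ℝ) : tail (cons a z) = z := rfl

lemma measurable_tail : Measurable tail := by unfold tail; fun_prop

lemma measurable_cons : Measurable fun p : ℝ × (ℕ → ℝ) => cons p.1 p.2 := by
  refine measurable_pi_iff.2 fun j => ?_
  cases j with
  | zero => exact measurable_fst
  | succ j => exact (measurable_pi_apply j).comp measurable_snd

/-- Law of a sequence of independent random variables with law `ρ`. -/
noncomputable abbrev iidLaw (ρ : Measure ℝ) : Measure (ℕ → ℝ) := Measure.infinitePi fun _ => ρ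

lemma measurePreserving_cons (ρ : Measure ℝ) [IsProbabilityMeasure ρ] :
    MeasurePreserving (fun p : ℝ × (ℕ → ℝ) => cons p.1 p.2) (ρ.prod (iidLaw ρ)) (iidLaw ρ) := by
  classical
  refine ⟨measurable_cons, Measure.eq_infinitePi _ fun s t ht => ?_⟩
  -- Padding the cylinder with `Set.univ` makes its index set an initial segment, on which dropping
  -- the first coordinate is a plain shift.
  obtain ⟨n, hn⟩ : ∃ n, s ⊆ Finset.range (n + 1) :=
    ⟨s.sup id, fun i hi => Finset.mem_range.2 (Nat.lt_succ_of_le (Finset.le_sup (f := id) hi))⟩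
  set t' : ℕ → Set ℝ := fun i => if i ∈ s then t i else Set.univ with ht'
  have hmt' : ∀ i, MeasurableSet (t' i) := fun i => by
    by_cases hi : i ∈ s <;> simp [ht', hi, ht i]
  have hset : Set.pi (s : Set ℕ) t = Set.pi (Finset.range (n + 1) : Set ℕ) t' := by
    ext z
    simp only [Set.mem_pi, ht']
    constructor
    · intro h i _
      by_cases hi : i ∈ s
      · simpa [hi] using h i hi
      · simp [hi]
    · intro h i hi
      have := h i (hn hi)
      have hi' : i ∈ s := hi
      simpa [hi'] using this
  have hprod : ∏ i ∈ s, ρ (t i) = ∏ i ∈ Finset.range (n + 1), ρ (t' i) := by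
    rw [← Finset.prod_subset hn]
    · exact Finset.prod_congr rfl fun i hi => by simp [ht', hi]
    · intro i _ hi; simp [ht', hi]
  have hpre : (fun p : ℝ × (ℕ → ℝ) => cons p.1 p.2) ⁻¹'
      Set.pi (Finset.range (n + 1) : Set ℕ) t' =
      t' 0 ×ˢ Set.pi (Finset.range n : Set ℕ) (fun i => t' (i + 1)) := by
    ext ⟨a, z⟩
    simp only [Set.mem_preimage, Set.mem_pi, Set.mem_prod, Finset.coe_range, Set.mem_Iio]
    constructor
    · intro h
      exact ⟨h 0 (by omega), fun i hi => h (i + 1) (by omega)⟩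
    · rintro ⟨h0, h⟩ i hi
      cases i with
      | zero => exact h0
      | succ i => exact h i (by omega)
  rw [hset, hprod, Measure.map_apply measurable_cons
    (MeasurableSet.pi (Finset.countable_toSet _) fun i _ => hmt' i), hpre, Measure.prod_prod,
    Measure.infinitePi_pi _ (fun i _ => hmt' (i + 1)), Finset.prod_range_succ', mul_comm]

lemma measurePreserving_headTail (ρ : Measure ℝ) [IsProbabilityMeasure ρ] :
    MeasurePreserving (fun z : ℕ → ℝ => (z 0, tail z)) (iidLaw ρ) (ρ.prod (iidLaw ρ)) := by
  refine ⟨(measurable_pi_apply 0).prodMk measurable_tail, ?_⟩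
  conv_lhs => rw [← (measurePreserving_cons ρ).map_eq]
  rw [Measure.map_map ((measurable_pi_apply 0).prodMk measurable_tail) measurable_cons]
  exact Measure.map_id

lemma measurePreserving_tail (ρ : Measure ℝ) [IsProbabilityMeasure ρ] :
    MeasurePreserving tail (iidLaw ρ) (iidLaw ρ) :=
  measurePreserving_snd.comp (measurePreserving_headTail ρ)

instance isProbabilityMeasure_sumElim (ρ σ : Measure ℝ) [IsProbabilityMeasure ρ]
    [IsProbabilityMeasure σ] (i : ℕ ⊕ ℕ) :
    IsProbabilityMeasure ((Sum.elim (fun _ => ρ) (fun _ => σ) : ℕ ⊕ ℕ → Measure ℝ) i) := by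
  rcases i with i | i <;> simpa

lemma measurable_sumElim : Measurable
    (fun p : (ℕ → ℝ) × (ℕ → ℝ) => (Sum.elim p.1 p.2 : ℕ ⊕ ℕ → ℝ)) := by
  refine measurable_pi_iff.2 ?_
  rintro (i | i)
  · exact (measurable_pi_apply i).comp measurable_fst
  · exact (measurable_pi_apply i).comp measurable_snd

lemma measurable_sumElim_symm :
    Measurable (fun f : ℕ ⊕ ℕ → ℝ => (fun i => f (Sum.inl i), fun i => f (Sum.inr i))) := by
  fun_prop

/-- Joint independence over `ℕ ⊕ ℕ` becomes a product of two sequence laws, so that one sequence can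
be frozen while the other is integrated. -/
lemma measurePreserving_sumElim (ρ σ : Measure ℝ) [IsProbabilityMeasure ρ]
    [IsProbabilityMeasure σ] :
    MeasurePreserving (fun p : (ℕ → ℝ) × (ℕ → ℝ) => (Sum.elim p.1 p.2 : ℕ ⊕ ℕ → ℝ))
      ((iidLaw ρ).prod (iidLaw σ))
      (Measure.infinitePi (Sum.elim (fun _ => ρ) (fun _ => σ) : ℕ ⊕ ℕ → Measure ℝ)) := by
  classical
  refine ⟨measurable_sumElim, Measure.eq_infinitePi _ fun s t ht => ?_⟩
  have hpre : (fun p : (ℕ → ℝ) × (ℕ → ℝ) => (Sum.elim p.1 p.2 : ℕ ⊕ ℕ → ℝ)) ⁻¹'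
      Set.pi (s : Set (ℕ ⊕ ℕ)) t =
      Set.pi (s.toLeft : Set ℕ) (fun i => t (Sum.inl i)) ×ˢ
        Set.pi (s.toRight : Set ℕ) (fun i => t (Sum.inr i)) := by
    ext ⟨a, b⟩
    simp [Set.mem_pi]
  rw [Measure.map_apply measurable_sumElim
    (MeasurableSet.pi (Finset.countable_toSet _) fun i _ => ht i), hpre,
    Measure.prod_prod, Measure.infinitePi_pi _ (fun i _ => ht _),
    Measure.infinitePi_pi _ (fun i _ => ht _)]
  conv_rhs => rw [← Finset.toLeft_disjSum_toRight (u := s), Finset.prod_disjSum]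
  simp

/-! ### The residual of a renewal sequence with exponential gaps -/

lemma iidLaw_apply_eq_lintegral (ρ : Measure ℝ) [IsProbabilityMeasure ρ] {S : Set (ℕ → ℝ)}
    (hS : MeasurableSet S) : iidLaw ρ S = ∫⁻ u, iidLaw ρ {t | cons u t ∈ S} ∂ρ := by
  rw [← (measurePreserving_cons ρ).measure_preimage hS.nullMeasurableSet,
    Measure.prod_apply (measurable_cons hS)]
  rfl

@[fun_prop]
lemma measurable_sourceArrival (n : ℕ) : Measurable fun z => sourceArrival z n := by
  unfold sourceArrival; fun_prop

lemma sourceArrival_zero (z : ℕ → ℝ) : sourceArrival z 0 = z 0 := by simp [sourceArrival]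

lemma sourceArrival_succ (z : ℕ → ℝ) (n : ℕ) :
    sourceArrival z (n + 1) = z 0 + sourceArrival (tail z) n := by
  unfold sourceArrival tail
  rw [Finset.sum_range_succ', add_comm]

lemma sourceArrival_add (z : ℕ → ℝ) (m n : ℕ) :
    sourceArrival z (m + 1 + n) =
      sourceArrival z m + sourceArrival (fun j => z (m + 1 + j)) n := by
  unfold sourceArrival
  rw [add_assoc (m + 1) n 1, Finset.sum_range_add]

/-- Seen from time `x`, the gaps of the renewal sequence from its `m`-th arrival on. -/
def restart (m : ℕ) (x : ℝ) (z : ℕ → ℝ) : ℕ → ℝ :=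
  cons (sourceArrival z m - x) fun j => z (m + 1 + j)

lemma measurable_restart (m : ℕ) :
    Measurable fun p : ℝ × (ℕ → ℝ) => restart m p.1 p.2 := by
  have h : Measurable fun p : ℝ × (ℕ → ℝ) =>
      (sourceArrival p.2 m - p.1, fun j => p.2 (m + 1 + j)) := by fun_prop
  exact measurable_cons.comp h

/-- The `m`-th arrival is the first one that is not before `x`. -/
def passageSet (m : ℕ) (x : ℝ) : Set (ℕ → ℝ) :=
  {z | (∀ i < m, sourceArrival z i < x) ∧ x ≤ sourceArrival z m}

lemma measurableSet_passage (m : ℕ) :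
    MeasurableSet {p : ℝ × (ℕ → ℝ) | p.2 ∈ passageSet m p.1} := by
  have : {p : ℝ × (ℕ → ℝ) | p.2 ∈ passageSet m p.1} =
      (⋂ i, ⋂ _ : i < m, {p | sourceArrival p.2 i < p.1}) ∩
        {p | p.1 ≤ sourceArrival p.2 m} := by
    ext p; simp [passageSet]
  rw [this]
  exact (MeasurableSet.iInter fun i => MeasurableSet.iInter fun _ =>
    measurableSet_lt (by fun_prop) (by fun_prop)).inter
      (measurableSet_le (by fun_prop) (by fun_prop))

lemma measurableSet_passageSet (m : ℕ) (x : ℝ) : MeasurableSet (passageSet m x) :=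
  measurable_prodMk_left (measurableSet_passage m)

/-- Conditioning on the first gap `u` lowers the level from `x` to `x - u` and the index by one: the
recursion for the induction on `m`. -/
lemma cons_mem_passageSet_succ (m : ℕ) (x u : ℝ) (t : ℕ → ℝ) :
    cons u t ∈ passageSet (m + 1) x ↔ u < x ∧ t ∈ passageSet m (x - u) := by
  simp only [passageSet, Set.mem_ofPred_eq, sourceArrival_succ, tail_cons, cons_zero]
  constructor
  · rintro ⟨h1, h2⟩
    refine ⟨by simpa [sourceArrival_zero] using h1 0 (by omega), fun i hi => ?_, by linarith⟩
    have := h1 (i + 1) (by omega)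
    rw [sourceArrival_succ, tail_cons, cons_zero] at this
    linarith
  · rintro ⟨h0, h1, h2⟩
    refine ⟨fun i hi => ?_, by linarith⟩
    cases i with
    | zero => simpa [sourceArrival_zero] using h0
    | succ i =>
      have := h1 i (by omega)
      rw [sourceArrival_succ, tail_cons, cons_zero]
      linarith

lemma restart_succ_cons (m : ℕ) (x u : ℝ) (t : ℕ → ℝ) :
    restart (m + 1) x (cons u t) = restart m (x - u) t := by
  funext j
  cases j with
  | zero => simp only [restart, cons_zero, sourceArrival_succ, tail_cons]; ring
  | succ j =>
    simp only [restart, cons_succ]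
    rw [show m + 1 + 1 + j = (m + 1 + j) + 1 by ring, cons_succ]

/-- Overshoot and later gaps are fresh and independent of which arrival passes `x` first. For `m =
0` this is memorylessness of the first gap; for `m + 1` the first gap `u < x` is integrated out and
the claim holds at level `x - u`. -/
lemma iidLaw_passageSet_inter_restart (r : ℝ) [Fact (0 < r)] (m : ℕ) {x : ℝ} (hx : 0 ≤ x)
    {A : Set (ℕ → ℝ)} (hA : MeasurableSet A) :
    iidLaw (expMeasure r) (passageSet m x ∩ restart m x ⁻¹' A) =
      iidLaw (expMeasure r) (passageSet m x) * iidLaw (expMeasure r) A := by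
  have hmeas : ∀ (m : ℕ) (x : ℝ) {A : Set (ℕ → ℝ)}, MeasurableSet A →
      MeasurableSet (passageSet m x ∩ restart m x ⁻¹' A) := fun m x A hA =>
    (measurableSet_passageSet m x).inter (((measurable_restart m).comp measurable_prodMk_left) hA)
  induction m generalizing x with
  | zero =>
    have key : ∀ {A : Set (ℕ → ℝ)}, MeasurableSet A →
        iidLaw (expMeasure r) (passageSet 0 x ∩ restart 0 x ⁻¹' A) =
          ENNReal.ofReal (Real.exp (-(r * x))) * iidLaw (expMeasure r) A := by
      intro A hA
      rw [iidLaw_apply_eq_lintegral _ (hmeas 0 x hA), iidLaw_apply_eq_lintegral _ hA,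
        ← lintegral_expMeasure_Ici_sub r hx
          (f := fun u => iidLaw (expMeasure r) {t | cons u t ∈ A})
          (measurable_measure_prodMk_left (measurable_cons hA)),
        ← lintegral_indicator measurableSet_Ici]
      refine lintegral_congr fun u => ?_
      have hr0 : ∀ t, restart 0 x (cons u t) = cons (u - x) t := by
        intro t
        funext j
        cases j with
        | zero => simp [restart, sourceArrival_zero]
        | succ j => simp only [restart, cons_succ]; rw [add_comm (0 + 1) j]; simp
      by_cases hu : x ≤ u
      · simp [passageSet, sourceArrival_zero, hu, hr0]
      · simp [passageSet, sourceArrival_zero, hu]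
    -- The case of the whole space identifies the factor `exp (-(r * x))` as the probability of the
    -- passage event.
    have h1 := key MeasurableSet.univ
    simp only [Set.preimage_univ, Set.inter_univ, measure_univ, mul_one] at h1
    rw [key hA, h1]
  | succ m ih =>
    rw [iidLaw_apply_eq_lintegral _ (hmeas (m + 1) x hA),
      iidLaw_apply_eq_lintegral _ (measurableSet_passageSet (m + 1) x),
      ← lintegral_mul_const' _ _ (measure_ne_top _ _)]
    refine lintegral_congr fun u => ?_
    simp only [Set.mem_inter_iff, cons_mem_passageSet_succ, Set.mem_preimage, restart_succ_cons]
    by_cases hu : u < x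
    · simp only [hu, true_and]
      exact ih (sub_nonneg.2 hu.le)
    · simp [hu]

lemma tendsto_sum_atTop_of_average {a : ℕ → ℝ} {c : ℝ} (hc : 0 < c)
    (h : Tendsto (fun n : ℕ => (∑ i ∈ Finset.range n, a i) / n) atTop (𝓝 c)) :
    Tendsto (fun n : ℕ => ∑ i ∈ Finset.range n, a i) atTop atTop := by
  refine (h.pos_mul_atTop hc tendsto_natCast_atTop_atTop).congr' ?_
  filter_upwards [eventually_gt_atTop 0] with n hn
  have : (n : ℝ) ≠ 0 := by positivity
  field_simp

/-- The strong law applies with mean gap `1 / r > 0`. Divergence is what keeps the infima defining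
`servedIndex` and `passageIndex` off the empty set. -/
lemma ae_tendsto_sourceArrival (r : ℝ) [hr : Fact (0 < r)] :
    ∀ᵐ z ∂(iidLaw (expMeasure r)), Tendsto (sourceArrival z) atTop atTop := by
  have hmp := fun i : ℕ => measurePreserving_eval_infinitePi (fun _ : ℕ => expMeasure r) i
  have hid : ∀ i, IdentDistrib (fun z : ℕ → ℝ => z i) (fun z => z 0)
      (iidLaw (expMeasure r)) (iidLaw (expMeasure r)) := fun i =>
    ⟨(measurable_pi_apply i).aemeasurable, (measurable_pi_apply 0).aemeasurable,
      (hmp i).map_eq.trans (hmp 0).map_eq.symm⟩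
  have hind := iIndepFun_infinitePi (P := fun _ : ℕ => expMeasure r)
    (X := fun _ u => u) (fun _ => measurable_id)
  have hint : Integrable (fun z : ℕ → ℝ => z 0) (iidLaw (expMeasure r)) :=
    (hmp 0).integrable_comp_of_integrable (integrable_id_expMeasure r)
  have hmean : ∫ z : ℕ → ℝ, z 0 ∂(iidLaw (expMeasure r)) = 1 / r := by
    rw [← integral_id_expMeasure r]
    exact ((hmp 0).hasLaw.integral_comp aestronglyMeasurable_id)
  filter_upwards [strong_law_ae_real (fun i (z : ℕ → ℝ) => z i) hint
    (fun i j hij => hind.indepFun hij) hid] with z hz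
  rw [hmean] at hz
  exact (tendsto_sum_atTop_of_average (one_div_pos.2 hr.out) hz).comp (tendsto_add_atTop_nat 1)

/-- Index of the first arrival that is not before `x`. -/
noncomputable def passageIndex (x : ℝ) (z : ℕ → ℝ) : ℕ := sInf {n | x ≤ sourceArrival z n}

lemma passageIndex_eq_of_mem {x : ℝ} {z : ℕ → ℝ} {m : ℕ} (h : z ∈ passageSet m x) :
    passageIndex x z = m := by
  refine le_antisymm (Nat.sInf_le h.2) ?_
  refine le_csInf ⟨m, h.2⟩ fun n hn => ?_
  by_contra! hlt
  exact absurd hn (not_le.2 (h.1 n hlt))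

lemma mem_passageSet_passageIndex {x : ℝ} {z : ℕ → ℝ} (h : ∃ n, x ≤ sourceArrival z n) :
    z ∈ passageSet (passageIndex x z) x :=
  ⟨fun _ hi => not_le.1 fun hle => Nat.notMem_of_lt_sInf hi hle, Nat.sInf_mem h⟩

lemma measurable_passageIndex :
    Measurable fun p : ℝ × (ℕ → ℝ) => passageIndex p.1 p.2 := by
  -- Only positive values characterise the passage event, since `sInf ∅ = 0`; the preimage of `0` is
  -- then obtained as the complement of the others.
  have hsucc : ∀ n, (fun p : ℝ × (ℕ → ℝ) => passageIndex p.1 p.2) ⁻¹' {n + 1} =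
      {p | p.2 ∈ passageSet (n + 1) p.1} := by
    intro n
    ext p
    simp only [Set.mem_preimage, Set.mem_singleton_iff, Set.mem_ofPred_eq]
    refine ⟨fun h => ?_, passageIndex_eq_of_mem⟩
    rw [← h]
    refine mem_passageSet_passageIndex ?_
    by_contra hne
    have : {n | p.1 ≤ sourceArrival p.2 n} = ∅ := by
      ext k; simpa using not_exists.1 hne k
    rw [passageIndex, this] at h
    simp at h
  refine measurable_to_countable' fun n => ?_
  cases n with
  | succ n => rw [hsucc]; exact measurableSet_passage _
  | zero =>
    have : (fun p : ℝ × (ℕ → ℝ) => passageIndex p.1 p.2) ⁻¹' {0} =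
        (⋃ n, (fun p : ℝ × (ℕ → ℝ) => passageIndex p.1 p.2) ⁻¹' {n + 1})ᶜ := by
      ext p
      simp only [Set.mem_preimage, Set.mem_singleton_iff, Set.mem_compl_iff, Set.mem_iUnion,
        not_exists]
      constructor
      · intro h n; omega
      · intro h
        by_contra h0
        exact h (passageIndex p.1 p.2 - 1) (by omega)
    rw [this]
    refine (MeasurableSet.iUnion fun n => ?_).compl
    rw [hsucc]; exact measurableSet_passage _

/-- The arrivals after time `x`: the residual gap at `x`, followed by the later gaps. -/
noncomputable def residual (x : ℝ) (z : ℕ → ℝ) : ℕ → ℝ := restart (passageIndex x z) x z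

lemma measurable_residual : Measurable (Function.uncurry residual) := by
  have h : Measurable fun q : (ℝ × (ℕ → ℝ)) × ℕ => restart q.2 q.1.1 q.1.2 :=
    measurable_from_prod_countable_left fun m => measurable_restart m
  exact h.comp (measurable_id.prodMk measurable_passageIndex)

/-- The passage events partition the space up to a null set. On each of them the probability
factorises with the same factor `ν A`, and the other factors sum to one. -/
lemma measurePreserving_residual (r : ℝ) [Fact (0 < r)] {x : ℝ} (hx : 0 ≤ x) :
    MeasurePreserving (residual x) (iidLaw (expMeasure r)) (iidLaw (expMeasure r)) := by
  set ν := iidLaw (expMeasure r)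
  have hmr : Measurable (residual x) := measurable_residual.of_uncurry_left
  have hae : ∀ᵐ z ∂ν, z ∈ ⋃ m, passageSet m x := by
    filter_upwards [ae_tendsto_sourceArrival r] with z hz
    exact Set.mem_iUnion.2 ⟨_, mem_passageSet_passageIndex
      (hz.eventually (eventually_ge_atTop x)).exists⟩
  have hdisj : Pairwise (Function.onFun Disjoint fun m => passageSet m x) := by
    intro m n hmn
    exact Set.disjoint_left.2 fun z (hm : z ∈ passageSet m x) (hn : z ∈ passageSet n x) =>
      hmn ((passageIndex_eq_of_mem hm).symm.trans (passageIndex_eq_of_mem hn))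
  have hsum : ∀ S : Set (ℕ → ℝ), MeasurableSet S → ν S = ∑' m, ν (passageSet m x ∩ S) := by
    intro S hS
    rw [← measure_iUnion (fun m n hmn => (hdisj hmn).mono Set.inter_subset_left
      Set.inter_subset_left) (fun m => (measurableSet_passageSet m x).inter hS),
      ← Set.iUnion_inter]
    refine measure_congr ?_
    filter_upwards [hae] with z hz
    exact propext ⟨fun h => ⟨hz, h⟩, fun h => h.2⟩
  refine ⟨hmr, Measure.ext fun A hA => ?_⟩
  rw [Measure.map_apply hmr hA, hsum _ (hmr hA)]
  calc ∑' m, ν (passageSet m x ∩ residual x ⁻¹' A)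
      = ∑' m, ν (passageSet m x) * ν A := by
        refine tsum_congr fun m => ?_
        rw [← iidLaw_passageSet_inter_restart r m hx hA]
        congr 1
        ext z
        simp only [Set.mem_inter_iff, Set.mem_preimage]
        refine and_congr_right fun hz => ?_
        rw [residual, passageIndex_eq_of_mem hz]
    _ = ν A := by
        rw [ENNReal.tsum_mul_right]
        have := hsum Set.univ MeasurableSet.univ
        simp only [Set.inter_univ, measure_univ] at this
        rw [← this, one_mul]

/-! ### The idle periods -/

/-- `idle x z k` is the length of the idle period after the `k`-th service, when the services have
durations `x` and `z` are the gaps of the arrivals from the beginning of the first service on. -/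
noncomputable def idle (x z : ℕ → ℝ) : ℕ → ℝ
  | 0 => residual (x 0) z 0
  | k + 1 => idle (tail x) (tail (residual (x 0) z)) k

/-- The first `n` idle periods, followed by the gaps of the arrivals after the last of them. -/
noncomputable def idleThenGaps : ℕ → (ℕ → ℝ) → (ℕ → ℝ) → ℕ → ℝ
  | 0, _, z => z
  | n + 1, x, z => cons (residual (x 0) z 0) (idleThenGaps n (tail x) (tail (residual (x 0) z)))

lemma idleThenGaps_apply_of_lt {n k : ℕ} (h : k < n) (x z : ℕ → ℝ) :
    idleThenGaps n x z k = idle x z k := by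
  induction n generalizing k x z with
  | zero => omega
  | succ n ih =>
    cases k with
    | zero => rfl
    | succ k => exact ih (by omega) _ _

/-- Keeping the unused gaps behind the extracted idle periods closes the induction: each stage maps
an i.i.d. sequence to an i.i.d. sequence. -/
lemma measurePreserving_idleThenGaps (r : ℝ) [Fact (0 < r)] (n : ℕ) {x : ℕ → ℝ}
    (hx : ∀ k, 0 ≤ x k) :
    MeasurePreserving (idleThenGaps n x) (iidLaw (expMeasure r)) (iidLaw (expMeasure r)) := by
  induction n generalizing x with
  | zero => exact MeasurePreserving.id _
  | succ n ih =>
    exact (measurePreserving_cons (expMeasure r)).comp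
      (((MeasurePreserving.id _).prod (ih (x := tail x) fun k => hx (k + 1))).comp
        ((measurePreserving_headTail (expMeasure r)).comp (measurePreserving_residual r (hx 0))))

lemma measurable_idle : Measurable (Function.uncurry idle) := by
  have h : ∀ k, Measurable fun p : (ℕ → ℝ) × (ℕ → ℝ) => idle p.1 p.2 k := by
    intro k
    have hres : Measurable fun p : (ℕ → ℝ) × (ℕ → ℝ) => residual (p.1 0) p.2 :=
      Measurable.comp (g := Function.uncurry residual)
        (f := fun p : (ℕ → ℝ) × (ℕ → ℝ) => (p.1 0, p.2)) measurable_residual (by fun_prop)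
    induction k with
    | zero => exact (measurable_pi_apply 0).comp hres
    | succ k ih =>
      exact ih.comp ((measurable_tail.comp measurable_fst).prodMk (measurable_tail.comp hres))
  exact measurable_pi_iff.2 h

/-- A cylinder sees finitely many coordinates, and on these `idle` agrees with `idleThenGaps`. -/
lemma measurePreserving_idle (r : ℝ) [Fact (0 < r)] {x : ℕ → ℝ} (hx : ∀ k, 0 ≤ x k) :
    MeasurePreserving (idle x) (iidLaw (expMeasure r)) (iidLaw (expMeasure r)) := by
  have hm : Measurable (idle x) := measurable_idle.of_uncurry_left
  refine ⟨hm, Measure.eq_infinitePi _ fun s t ht => ?_⟩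
  have hs : MeasurableSet (Set.pi (s : Set ℕ) t) :=
    MeasurableSet.pi (Finset.countable_toSet _) fun i _ => ht i
  have hpre : idle x ⁻¹' Set.pi (s : Set ℕ) t =
      idleThenGaps (s.sup id + 1) x ⁻¹' Set.pi (s : Set ℕ) t := by
    ext z
    simp only [Set.mem_preimage, Set.mem_pi]
    refine forall₂_congr fun i hi => ?_
    rw [idleThenGaps_apply_of_lt (Nat.lt_succ_of_le (show i ≤ s.sup id from Finset.le_sup (f := id) hi))]
  rw [Measure.map_apply hm hs, hpre,
    (measurePreserving_idleThenGaps r _ hx).measure_preimage hs.nullMeasurableSet,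
    Measure.infinitePi_pi _ fun i _ => ht i]

variable {Ω : Type*} [MeasurableSpace Ω]

/-- The idle period after the `k`-th service, as a random variable. -/
noncomputable def idlePeriod (Z X : ℕ → Ω → ℝ) (k : ℕ) (ω : Ω) : ℝ :=
  idle (fun n => X n ω) (tail fun n => Z n ω) k

section

variable {P : Measure Ω} {Z X : ℕ → Ω → ℝ} {lam mu : ℝ}

lemma IsMM11.measurable_idlePeriod (h : IsMM11 P Z X lam mu) (k : ℕ) :
    Measurable (idlePeriod Z X k) := by
  have hX : Measurable fun ω n => X n ω := measurable_pi_iff.2 h.measurable_service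
  have hZ : Measurable fun ω n => Z n ω := measurable_pi_iff.2 h.measurable_interarrival
  exact (measurable_pi_apply k).comp
    (measurable_idle.comp (hX.prodMk (measurable_tail.comp hZ)))

lemma IsMM11.measurable_sumElim_idlePeriod (h : IsMM11 P Z X lam mu) (i : ℕ ⊕ ℕ) :
    Measurable ((Sum.elim (idlePeriod Z X) X : ℕ ⊕ ℕ → Ω → ℝ) i) := by
  rcases i with i | i
  exacts [h.measurable_idlePeriod i, h.measurable_service i]

variable [Fact (0 < lam)] [Fact (0 < mu)]

/-- Service times and interarrival times as a pair of independent i.i.d. sequences. -/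
lemma IsMM11.measurePreserving_input (h : IsMM11 P Z X lam mu) :
    MeasurePreserving (fun ω => ((fun n => Z n ω, fun n => X n ω) : (ℕ → ℝ) × (ℕ → ℝ))) P
      ((iidLaw (expMeasure lam)).prod (iidLaw (expMeasure mu))) := by
  have hm : ∀ i, Measurable ((Sum.elim Z X : ℕ ⊕ ℕ → Ω → ℝ) i) := by
    rintro (i | i)
    exacts [h.measurable_interarrival i, h.measurable_service i]
  have hmap := h.indep.map_fun_eq_infinitePi_map hm
  have hlaw : (fun i => P.map ((Sum.elim Z X : ℕ ⊕ ℕ → Ω → ℝ) i)) =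
      Sum.elim (fun _ => expMeasure lam) (fun _ => expMeasure mu) := by
    funext i
    rcases i with i | i
    exacts [h.map_interarrival i, h.map_service i]
  rw [show Measure.infinitePi (fun i => P.map ((Sum.elim Z X : ℕ ⊕ ℕ → Ω → ℝ) i)) =
    Measure.infinitePi (Sum.elim (fun _ => expMeasure lam) (fun _ => expMeasure mu)) by
      rw [hlaw]] at hmap
  have h1 : MeasurePreserving (fun ω i => (Sum.elim Z X : ℕ ⊕ ℕ → Ω → ℝ) i ω) P _ :=
    ⟨measurable_pi_iff.2 hm, hmap⟩
  have h2 : MeasurePreserving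
      (fun f : ℕ ⊕ ℕ → ℝ => (fun i => f (Sum.inl i), fun i => f (Sum.inr i)))
      (Measure.infinitePi (Sum.elim (fun _ => expMeasure lam) (fun _ => expMeasure mu)))
      ((iidLaw (expMeasure lam)).prod (iidLaw (expMeasure mu))) := by
    refine ⟨measurable_sumElim_symm, ?_⟩
    rw [← (measurePreserving_sumElim (expMeasure lam) (expMeasure mu)).map_eq,
      Measure.map_map measurable_sumElim_symm measurable_sumElim]
    exact Measure.map_id
  exact h2.comp h1

/-- For almost every service sequence the map from gaps to idle periods preserves the same law, so
the skew product over services preserves the product measure. The first gap is dropped because it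
precedes the first service. -/
lemma IsMM11.measurePreserving_idlePeriod (h : IsMM11 P Z X lam mu) :
    MeasurePreserving (fun ω => ((fun n => idlePeriod Z X n ω, fun n => X n ω) :
      (ℕ → ℝ) × (ℕ → ℝ))) P
      ((iidLaw (expMeasure lam)).prod (iidLaw (expMeasure mu))) := by
  have h1 := (((measurePreserving_tail (expMeasure lam)).prod
    (MeasurePreserving.id (iidLaw (expMeasure mu)))).comp h.measurePreserving_input)
  have hpos : ∀ᵐ x ∂(iidLaw (expMeasure mu)), ∀ k, 0 ≤ x k := by
    refine ae_all_iff.2 fun k => ?_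
    exact ((measurePreserving_eval_infinitePi (fun _ : ℕ => expMeasure mu) k).quasiMeasurePreserving.tendsto_ae
      |>.eventually (ae_pos_expMeasure mu)).mono fun x hx => le_of_lt hx
  have h2 : MeasurePreserving (fun p : (ℕ → ℝ) × (ℕ → ℝ) => (p.1, idle p.1 p.2))
      ((iidLaw (expMeasure mu)).prod (iidLaw (expMeasure lam)))
      ((iidLaw (expMeasure mu)).prod (iidLaw (expMeasure lam))) :=
    (MeasurePreserving.id _).skew_product measurable_idle
      (hpos.mono fun x hx => (measurePreserving_idle lam hx).map_eq)
  exact Measure.measurePreserving_swap.comp (h2.comp (Measure.measurePreserving_swap.comp h1))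

lemma IsMM11.map_idlePeriod (h : IsMM11 P Z X lam mu) (k : ℕ) :
    P.map (idlePeriod Z X k) = expMeasure lam :=
  ((measurePreserving_eval_infinitePi (fun _ : ℕ => expMeasure lam) k).comp
    (measurePreserving_fst.comp h.measurePreserving_idlePeriod)).map_eq

/-- All idle periods and service times are jointly independent. -/
lemma IsMM11.iIndepFun_idlePeriod [IsProbabilityMeasure P] (h : IsMM11 P Z X lam mu) :
    iIndepFun (Sum.elim (idlePeriod Z X) X) P := by
  have hm := h.measurable_sumElim_idlePeriod
  rw [iIndepFun_iff_map_fun_eq_infinitePi_map hm]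
  have hlaw : (fun i => P.map ((Sum.elim (idlePeriod Z X) X : ℕ ⊕ ℕ → Ω → ℝ) i)) =
      Sum.elim (fun _ => expMeasure lam) (fun _ => expMeasure mu) := by
    funext i
    rcases i with i | i
    exacts [h.map_idlePeriod i, h.map_service i]
  rw [show Measure.infinitePi (fun i => P.map ((Sum.elim (idlePeriod Z X) X : ℕ ⊕ ℕ → Ω → ℝ) i)) =
    Measure.infinitePi (Sum.elim (fun _ => expMeasure lam) (fun _ => expMeasure mu)) by
      rw [hlaw],
    ← ((measurePreserving_sumElim (expMeasure lam) (expMeasure mu)).comp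
      h.measurePreserving_idlePeriod).map_eq]
  congr 1
  funext ω i
  rcases i with i | i <;> rfl

end

/-! ### Sample paths -/

section Path

variable {z x : ℕ → ℝ}

/-- The gaps of the arrivals after the beginning of the `k`-th service. -/
noncomputable def gapsAfter (z x : ℕ → ℝ) (k : ℕ) : ℕ → ℝ := fun j => z (servedIndex z x k + 1 + j)

/-- Time between two successive departures, expressed through the idle period. -/
noncomputable def cycleLength (z x : ℕ → ℝ) (k : ℕ) : ℝ := idle x (tail z) k + x (k + 1)

lemma sourceArrival_gapsAfter (z x : ℕ → ℝ) (k n : ℕ) :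
    sourceArrival z (servedIndex z x k + 1 + n) =
      arrivalTime z x k + sourceArrival (gapsAfter z x k) n :=
  sourceArrival_add z _ n

lemma exists_le_sourceArrival_gapsAfter (hS : Tendsto (sourceArrival z) atTop atTop)
    (k : ℕ) (c : ℝ) :
    ∃ n, c ≤ sourceArrival (gapsAfter z x k) n := by
  obtain ⟨n, hn1, hn2⟩ := ((hS.eventually (eventually_ge_atTop (arrivalTime z x k + c))).and
    (eventually_ge_atTop (servedIndex z x k + 1))).exists
  obtain ⟨j, rfl⟩ := Nat.exists_eq_add_of_le hn2
  rw [sourceArrival_gapsAfter] at hn1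
  exact ⟨j, by linarith⟩

lemma servedIndex_succ (hS : Tendsto (sourceArrival z) atTop atTop)
    (k : ℕ) : servedIndex z x (k + 1) =
    servedIndex z x k + 1 + passageIndex (x k) (gapsAfter z x k) := by
  have hmem := mem_passageSet_passageIndex (exists_le_sourceArrival_gapsAfter (x := x) hS k (x k))
  refine IsLeast.csInf_eq ⟨⟨by omega, ?_⟩, fun n hn => ?_⟩
  · rw [sourceArrival_gapsAfter]
    have := hmem.2
    unfold arrivalTime
    linarith
  · obtain ⟨j, rfl⟩ := Nat.exists_eq_add_of_le (Nat.succ_le_of_lt hn.1)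
    have h2 := hn.2
    rw [Nat.succ_eq_add_one, sourceArrival_gapsAfter] at h2
    have : passageIndex (x k) (gapsAfter z x k) ≤ j :=
      Nat.sInf_le (show x k ≤ sourceArrival (gapsAfter z x k) j by unfold arrivalTime at h2; linarith)
    omega

lemma arrivalTime_succ_eq_residual (hS : Tendsto (sourceArrival z) atTop atTop)
    (k : ℕ) : arrivalTime z x (k + 1) =
    departureTime z x k + residual (x k) (gapsAfter z x k) 0 := by
  rw [arrivalTime, servedIndex_succ hS, sourceArrival_gapsAfter, departureTime, residual, restart,
    cons_zero]
  ring

lemma gapsAfter_succ (hS : Tendsto (sourceArrival z) atTop atTop)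
    (k : ℕ) :
    gapsAfter z x (k + 1) = tail (residual (x k) (gapsAfter z x k)) := by
  funext j
  rw [gapsAfter, servedIndex_succ hS, residual, restart, tail_cons, gapsAfter]
  congr 1
  ring

/-- `idle` shifts both of its arguments at every step, hence the free starting index `m` in the
induction on `k`. -/
lemma idle_gapsAfter (hS : Tendsto (sourceArrival z) atTop atTop)
    (m k : ℕ) : idle (fun j => x (m + j)) (gapsAfter z x m) k =
    residual (x (m + k)) (gapsAfter z x (m + k)) 0 := by
  induction k generalizing m with
  | zero => rfl
  | succ k ih =>
    have h := ih (m + 1)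
    rw [gapsAfter_succ hS] at h
    rw [show m + (k + 1) = m + 1 + k by ring, ← h]
    have hx : tail (fun j => x (m + j)) = fun j => x (m + 1 + j) := by
      funext j; simp only [tail]; congr 1; ring
    rw [← hx]
    rfl

lemma idle_eq_residual (hS : Tendsto (sourceArrival z) atTop atTop)
    (k : ℕ) :
    idle x (tail z) k = residual (x k) (gapsAfter z x k) 0 := by
  have h := idle_gapsAfter (x := x) hS 0 k
  simp only [zero_add] at h
  rw [← h]
  congr 1
  funext j
  simp only [gapsAfter, servedIndex, tail]
  congr 1
  ring

lemma arrivalTime_succ (hS : Tendsto (sourceArrival z) atTop atTop)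
    (k : ℕ) :
    arrivalTime z x (k + 1) = departureTime z x k + idle x (tail z) k := by
  rw [arrivalTime_succ_eq_residual hS, idle_eq_residual hS]

lemma departureTime_succ (hS : Tendsto (sourceArrival z) atTop atTop)
    (k : ℕ) :
    departureTime z x (k + 1) = departureTime z x k + cycleLength z x k := by
  rw [departureTime, arrivalTime_succ hS, cycleLength]
  ring

lemma idle_nonneg (hS : Tendsto (sourceArrival z) atTop atTop)
    (k : ℕ) : 0 ≤ idle x (tail z) k := by
  have h := (mem_passageSet_passageIndex
    (exists_le_sourceArrival_gapsAfter (x := x) hS k (x k))).2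
  rw [idle_eq_residual hS, residual, restart, cons_zero]
  linarith

lemma departureTime_eq_sum (hS : Tendsto (sourceArrival z) atTop atTop)
    (k : ℕ) : departureTime z x k =
    z 0 + x 0 + ∑ i ∈ Finset.range k, cycleLength z x i := by
  induction k with
  | zero => simp [departureTime, arrivalTime, servedIndex, sourceArrival]
  | succ k ih => rw [departureTime_succ hS, ih, Finset.sum_range_succ]; ring

lemma cycleLength_pos (hS : Tendsto (sourceArrival z) atTop atTop)
    (hx : ∀ k, 0 < x k) (k : ℕ) : 0 < cycleLength z x k :=
  add_pos_of_nonneg_of_pos (idle_nonneg hS k) (hx _)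

lemma strictMono_departureTime (hS : Tendsto (sourceArrival z) atTop atTop)
    (hx : ∀ k, 0 < x k) :
    StrictMono (departureTime z x) :=
  strictMono_nat_of_lt_succ fun k => by
    rw [departureTime_succ hS]
    linarith [cycleLength_pos hS hx k]

lemma monotone_arrivalTime (hS : Tendsto (sourceArrival z) atTop atTop)
    (hx : ∀ k, 0 < x k) :
    Monotone (arrivalTime z x) :=
  monotone_nat_of_le_succ fun k => by
    rw [arrivalTime_succ hS, departureTime]
    linarith [idle_nonneg (x := x) hS k, hx k]

lemma age_of_lt (hS : Tendsto (sourceArrival z) atTop atTop)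
    (hx : ∀ k, 0 < x k) {t : ℝ} (ht : t < departureTime z x 0) : age z x t = t := by
  have : {a | ∃ n, departureTime z x n ≤ t ∧ arrivalTime z x n = a} = ∅ := by
    refine Set.eq_empty_of_forall_notMem ?_
    rintro a ⟨n, hn, -⟩
    have := (strictMono_departureTime hS hx).monotone (Nat.zero_le n)
    linarith
  rw [age, this, Real.sSup_empty, sub_zero]

lemma age_of_mem_Ico (hS : Tendsto (sourceArrival z) atTop atTop)
    (hx : ∀ k, 0 < x k) {t : ℝ} {k : ℕ}
    (ht : t ∈ Set.Ico (departureTime z x k) (departureTime z x (k + 1))) :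
    age z x t = t - departureTime z x k + x k := by
  have : IsGreatest {a | ∃ n, departureTime z x n ≤ t ∧ arrivalTime z x n = a}
      (arrivalTime z x k) := by
    refine ⟨⟨k, ht.1, rfl⟩, ?_⟩
    rintro a ⟨n, hn, rfl⟩
    have : n < k + 1 := (strictMono_departureTime hS hx).lt_iff_lt.1 (hn.trans_lt ht.2)
    exact monotone_arrivalTime hS hx (by omega)
  rw [age, this.csSup_eq, departureTime]
  ring

/-- In the cycle the age equals `x k` plus the time since departure, so it exceeds `d` once `max 0
(d - x k)` has elapsed. -/
lemma exceedanceTime_succ (hS : Tendsto (sourceArrival z) atTop atTop)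
    (hx : ∀ k, 0 < x k) (d : ℝ) (k : ℕ) :
    exceedanceTime z x d (k + 1) = max 0 (cycleLength z x k - max 0 (d - x k)) := by
  have hset : {t | t ∈ Set.Ico (departureTime z x (k + 1 - 1)) (departureTime z x (k + 1)) ∧
      d < age z x t} =
      Set.Ico (departureTime z x k) (departureTime z x (k + 1)) ∩
        Set.Ioi (departureTime z x k + (d - x k)) := by
    ext t
    simp only [Nat.add_sub_cancel]
    refine and_congr_right fun ht => ?_
    rw [age_of_mem_Ico hS hx ht, Set.mem_Ioi]
    constructor <;> intro h <;> linarith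
  have hae : (Set.Ico (departureTime z x k) (departureTime z x (k + 1)) ∩
      Set.Ioi (departureTime z x k + (d - x k)) : Set ℝ) =ᵐ[volume]
      (Set.Ioo (max (departureTime z x k) (departureTime z x k + (d - x k)))
        (departureTime z x (k + 1)) : Set ℝ) := by
    rw [show Set.Ioo (max (departureTime z x k) (departureTime z x k + (d - x k)))
        (departureTime z x (k + 1)) = Set.Ioo (departureTime z x k) (departureTime z x (k + 1)) ∩
        Set.Ioi (departureTime z x k + (d - x k)) by
      ext t; simp only [Set.mem_Ioo, max_lt_iff, Set.mem_inter_iff, Set.mem_Ioi]; tauto]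
    exact Ioo_ae_eq_Ico.symm.inter (ae_eq_refl _)
  rw [exceedanceTime, hset, Measure.real, measure_congr hae, Real.volume_Ioo,
    departureTime_succ hS]
  rw [ENNReal.toReal_ofReal', max_comm]
  congr 1
  rcases le_total 0 (d - x k) with h | h
  · rw [max_eq_right (by linarith), max_eq_right h]; ring
  · rw [max_eq_left (by linarith), max_eq_left h]; ring

end Path

/-! ### The mean exceedance time of one cycle -/

/-- The exponential factor is `exp (-r * s) * exp (r * t)` up to `s` and `1` afterwards, so `G`
handles the first piece and `K` the second. Used with `h` an exponential density, for the tail of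
the cycle length, and with `h` that tail, for the mean exceedance. -/
lemma lintegral_Ioi_mul_exp_max {h G K : ℝ → ℝ} {r s : ℝ} (hs : 0 ≤ s)
    (h0 : ∀ t, 0 ≤ t → 0 ≤ h t) (hh : Continuous h)
    (hG : ∀ t, HasDerivAt G (h t * Real.exp (r * t)) t) (hK : ∀ t, HasDerivAt K (h t) t)
    (hlim : Tendsto K atTop (𝓝 0)) {v : ℝ}
    (hv : Real.exp (-r * s) * (G s - G 0) - K s = v) :
    0 ≤ v ∧ ∫⁻ t in Set.Ioi 0, ENNReal.ofReal (h t * Real.exp (-(r * max (s - t) 0))) =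
      ENNReal.ofReal v := by
  rw [neg_mul] at hv
  subst hv
  have hcont : Continuous fun t => h t * Real.exp (r * t) := by fun_prop
  have hG0 : 0 ≤ G s - G 0 := by
    rw [← intervalIntegral.integral_eq_sub_of_hasDerivAt (fun t _ => hG t)
      (hcont.intervalIntegrable _ _)]
    exact intervalIntegral.integral_nonneg hs fun t ht => mul_nonneg (h0 t ht.1) (Real.exp_pos _).le
  have hKint : IntegrableOn h (Set.Ioi s) :=
    integrableOn_Ioi_deriv_of_nonneg' (fun t _ => hK t) (fun t ht => h0 t (hs.trans (le_of_lt ht)))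
      hlim
  have hKs : ∫ t in Set.Ioi s, h t = 0 - K s :=
    integral_Ioi_of_hasDerivAt_of_tendsto' (fun t _ => hK t) hKint hlim
  have hKnn : 0 ≤ 0 - K s := by
    rw [← hKs]
    exact setIntegral_nonneg measurableSet_Ioi fun t ht => h0 t (hs.trans (le_of_lt ht))
  refine ⟨by linarith [mul_nonneg (Real.exp_pos (-(r * s))).le hG0], ?_⟩
  rw [← Set.Ioc_union_Ioi_eq_Ioi hs, lintegral_union measurableSet_Ioi
    (Set.Ioc_disjoint_Ioi le_rfl)]
  have e1 : ∫⁻ t in Set.Ioc 0 s, ENNReal.ofReal (h t * Real.exp (-(r * max (s - t) 0))) =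
      ENNReal.ofReal (Real.exp (-(r * s)) * (G s - G 0)) := by
    rw [setLIntegral_congr_fun (g := fun t =>
        ENNReal.ofReal (Real.exp (-(r * s)) * (h t * Real.exp (r * t)))) measurableSet_Ioc,
      ← ofReal_integral_eq_lintegral_ofReal, integral_const_mul,
      ← intervalIntegral.integral_of_le hs,
      intervalIntegral.integral_eq_sub_of_hasDerivAt (fun t _ => hG t)
        (hcont.intervalIntegrable _ _)]
    · exact ((hcont.const_mul _).integrableOn_Icc).mono_set Set.Ioc_subset_Icc_self
    · refine (ae_restrict_mem measurableSet_Ioc).mono fun t ht => ?_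
      exact mul_nonneg (Real.exp_pos _).le (mul_nonneg (h0 t ht.1.le) (Real.exp_pos _).le)
    · intro t ht
      simp only
      rw [max_eq_left (sub_nonneg.2 ht.2), mul_left_comm, ← Real.exp_add]
      congr 3
      ring
  have e2 : ∫⁻ t in Set.Ioi s, ENNReal.ofReal (h t * Real.exp (-(r * max (s - t) 0))) =
      ENNReal.ofReal (0 - K s) := by
    rw [setLIntegral_congr_fun (g := fun t => ENNReal.ofReal (h t)) measurableSet_Ioi,
      ← ofReal_integral_eq_lintegral_ofReal hKint, hKs]
    · exact (ae_restrict_mem measurableSet_Ioi).mono fun t ht => h0 t (hs.trans (le_of_lt ht))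
    · intro t ht
      simp only
      rw [max_eq_right (sub_nonpos.2 (le_of_lt ht))]
      simp
  rw [e1, e2, ← ENNReal.ofReal_add (mul_nonneg (Real.exp_pos _).le hG0) hKnn]
  congr 1
  ring

lemma hasDerivAt_exp_mul (c t : ℝ) :
    HasDerivAt (fun t => Real.exp (c * t)) (c * Real.exp (c * t)) t := by
  simpa [mul_comm] using ((hasDerivAt_id t).const_mul c).exp

lemma tendsto_exp_neg_mul {c : ℝ} (hc : 0 < c) :
    Tendsto (fun t => Real.exp (-c * t)) atTop (𝓝 0) :=
  Real.tendsto_exp_atBot.comp (tendsto_id.const_mul_atTop_of_neg (neg_neg_of_pos hc))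

/-- Tail of the sum of independent exponential variables with rates `lam` and `mu`. -/
noncomputable def cycleTail (lam mu s : ℝ) : ℝ :=
  if lam = mu then (1 + mu * s) * Real.exp (-mu * s)
  else (mu * Real.exp (-lam * s) - lam * Real.exp (-mu * s)) / (mu - lam)

/-- Mean exceedance time of the level `d` during one cycle. -/
noncomputable def meanExceedance (lam mu d : ℝ) : ℝ :=
  if lam = mu then mu * Real.exp (-mu * d) / 2 * (d + 2 / mu) ^ 2
  else mu ^ 2 * (Real.exp (-lam * d) - Real.exp (-mu * d)) / (lam * (mu - lam) ^ 2) +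
    Real.exp (-mu * d) * (1 / lam + 1 / mu - lam * d / (mu - lam))

/-- Given the first variable `u`, the second must exceed `s - u`. -/
lemma expMeasure_prod_lt_add {lam mu s : ℝ} [hlam : Fact (0 < lam)] [hmu : Fact (0 < mu)]
    (hs : 0 ≤ s) :
    ((expMeasure lam).prod (expMeasure mu)) {p | s < p.1 + p.2} =
      ENNReal.ofReal (cycleTail lam mu s) := by
  have hl := hlam.out
  have hset : ∀ u : ℝ, Prod.mk u ⁻¹' {p : ℝ × ℝ | s < p.1 + p.2} = Set.Ioi (s - u) := by
    intro u; ext v; simp [sub_lt_iff_lt_add']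
  rw [Measure.prod_apply (measurableSet_lt (by fun_prop) (by fun_prop))]
  simp only [hset, expMeasure_Ioi_max]
  rw [lintegral_expMeasure _ (by fun_prop), lintegral_indicator measurableSet_Ici,
    setLIntegral_congr Ioi_ae_eq_Ici.symm]
  have hcongr : ∀ u ∈ Set.Ioi (0 : ℝ), ENNReal.ofReal (lam * Real.exp (-(lam * u))) *
      ENNReal.ofReal (Real.exp (-(mu * max (s - u) 0))) =
      ENNReal.ofReal (lam * Real.exp (-lam * u) * Real.exp (-(mu * max (s - u) 0))) := by
    intro u _
    rw [← ENNReal.ofReal_mul (mul_nonneg hl.le (Real.exp_pos _).le), neg_mul]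
  rw [setLIntegral_congr_fun measurableSet_Ioi hcongr]
  have hK : ∀ t, HasDerivAt (fun t => -Real.exp (-lam * t)) (lam * Real.exp (-lam * t)) t := by
    intro t
    exact (hasDerivAt_exp_mul (-lam) t).neg.congr_deriv (by ring)
  have hlim : Tendsto (fun t => -Real.exp (-lam * t)) atTop (𝓝 0) := by
    simpa using (tendsto_exp_neg_mul hl).neg
  by_cases hne : lam = mu
  -- For equal rates the exponentials in the integrand cancel and its antiderivative is linear.
  · subst hne
    refine (lintegral_Ioi_mul_exp_max (G := fun t => lam * t) hs
      (fun t _ => mul_nonneg hl.le (Real.exp_pos _).le) (by fun_prop) ?_ hK hlim ?_).2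
    rotate_left
    · simp only [cycleTail, if_true]
      ring
    · intro t
      refine ((hasDerivAt_id t).const_mul lam).congr_deriv ?_
      rw [mul_assoc, ← Real.exp_add]
      simp
  · have hne' : mu - lam ≠ 0 := sub_ne_zero.2 (Ne.symm hne)
    refine (lintegral_Ioi_mul_exp_max
      (G := fun t => lam / (mu - lam) * Real.exp ((mu - lam) * t)) hs
      (fun t _ => mul_nonneg hl.le (Real.exp_pos _).le) (by fun_prop) ?_ hK hlim ?_).2
    rotate_left
    · simp only [cycleTail, if_neg hne]
      have hexp : Real.exp ((mu - lam) * s) * Real.exp (-mu * s) = Real.exp (-lam * s) := by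
        rw [← Real.exp_add]; congr 1; ring
      rw [← hexp]
      simp only [mul_zero, Real.exp_zero]
      field_simp
      ring
    · intro t
      refine ((hasDerivAt_exp_mul (mu - lam) t).const_mul (lam / (mu - lam))).congr_deriv ?_
      rw [mul_assoc, ← Real.exp_add, show -lam * t + mu * t = (mu - lam) * t by ring]
      field_simp

/-- The preceding identity cannot give this, because `ENNReal.ofReal` truncates. Numerator and
denominator share the sign of `mu - lam`. -/
lemma cycleTail_nonneg {lam mu s : ℝ} (hl : 0 < lam) (hm : 0 < mu) (hs : 0 ≤ s) :
    0 ≤ cycleTail lam mu s := by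
  unfold cycleTail
  split_ifs with h
  · positivity
  · rcases lt_or_gt_of_ne h with h | h
    · refine div_nonneg (sub_nonneg.2 ?_) (by linarith)
      exact mul_le_mul h.le (Real.exp_le_exp.2 (by nlinarith)) (Real.exp_pos _).le hm.le
    · refine div_nonneg_of_nonpos (sub_nonpos.2 ?_) (by linarith)
      exact mul_le_mul h.le (Real.exp_le_exp.2 (by nlinarith)) (Real.exp_pos _).le hl.le

lemma lintegral_cycleTail_mul_exp_max {lam mu d : ℝ} (hl : 0 < lam) (hm : 0 < mu) (hd : 0 ≤ d) :
    0 ≤ meanExceedance lam mu d ∧ ∫⁻ s in Set.Ioi 0,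
      ENNReal.ofReal (cycleTail lam mu s * Real.exp (-(mu * max (d - s) 0))) =
      ENNReal.ofReal (meanExceedance lam mu d) := by
  by_cases hne : lam = mu
  · subst hne
    have hc : cycleTail lam lam = fun s => (1 + lam * s) * Real.exp (-lam * s) := by
      funext s; simp [cycleTail]
    -- `G` integrates `1 + lam * t`, which is `cycleTail` times `exp (lam * t)`; `K` is the
    -- antiderivative of `cycleTail` vanishing at infinity.
    refine lintegral_Ioi_mul_exp_max (G := fun t => t + lam * t ^ 2 / 2)
      (K := fun t => -((2 / lam + t) * Real.exp (-lam * t))) hd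
      (fun t ht => cycleTail_nonneg hl hl ht) (by rw [hc]; fun_prop) ?_ ?_ ?_ ?_
    rotate_left 3
    · simp only [meanExceedance, if_true]
      field_simp
      ring
    · intro t
      rw [hc]
      refine ((hasDerivAt_id t).add
        ((((hasDerivAt_id t).pow 2).const_mul lam).div_const 2)).congr_deriv ?_
      simp only [mul_assoc, ← Real.exp_add]
      simp
      ring
    · intro t
      rw [hc]
      refine (((hasDerivAt_id t).const_add (2 / lam)).mul
        (hasDerivAt_exp_mul (-lam) t)).neg.congr_deriv ?_
      simp only [id]
      field_simp
      ring
    · have h1 := (tendsto_exp_neg_mul hl).const_mul (2 / lam)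
      have h2 : Tendsto (fun t : ℝ => t * Real.exp (-lam * t)) atTop (𝓝 0) := by
        simpa using tendsto_rpow_mul_exp_neg_mul_atTop_nhds_zero 1 lam hl
      convert (h1.add h2).neg using 1
      · funext t; ring
      · simp
  · have hne' : mu - lam ≠ 0 := sub_ne_zero.2 (Ne.symm hne)
    have hc : cycleTail lam mu =
        fun s => (mu * Real.exp (-lam * s) - lam * Real.exp (-mu * s)) / (mu - lam) := by
      funext s; simp [cycleTail, hne]
    refine lintegral_Ioi_mul_exp_max
      (G := fun t => (mu / (mu - lam) * Real.exp ((mu - lam) * t) - lam * t) / (mu - lam))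
      (K := fun t => (-(mu / lam) * Real.exp (-lam * t) + lam / mu * Real.exp (-mu * t)) /
        (mu - lam)) hd
      (fun t ht => cycleTail_nonneg hl hm ht) (by rw [hc]; fun_prop) ?_ ?_ ?_ ?_
    rotate_left 3
    · simp only [meanExceedance, if_neg hne]
      have hexp : Real.exp ((mu - lam) * d) * Real.exp (-mu * d) = Real.exp (-lam * d) := by
        rw [← Real.exp_add]; congr 1; ring
      rw [← hexp]
      simp only [mul_zero, Real.exp_zero]
      field_simp
      ring
    · intro t
      rw [hc]
      refine ((((hasDerivAt_exp_mul (mu - lam) t).const_mul (mu / (mu - lam))).sub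
        ((hasDerivAt_id t).const_mul lam)).div_const (mu - lam)).congr_deriv ?_
      have hexp : Real.exp ((mu - lam) * t) = Real.exp (-lam * t) * Real.exp (mu * t) := by
        rw [← Real.exp_add]; congr 1; ring
      have hexp' : Real.exp (-mu * t) * Real.exp (mu * t) = 1 := by
        rw [← Real.exp_add]; simp
      simp only [hexp]
      generalize Real.exp (-lam * t) = a, Real.exp (mu * t) = b, Real.exp (-mu * t) = c at hexp' ⊢
      field_simp
      linear_combination lam * hexp'
    · intro t
      rw [hc]
      refine ((((hasDerivAt_exp_mul (-lam) t).const_mul (-(mu / lam))).add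
        ((hasDerivAt_exp_mul (-mu) t).const_mul (lam / mu))).div_const (mu - lam)).congr_deriv ?_
      field_simp
      ring
    · simpa using (((tendsto_exp_neg_mul hl).const_mul (-(mu / lam))).add
        ((tendsto_exp_neg_mul hm).const_mul (lam / mu))).div_const (mu - lam)

/-- The integrand is the length of the set of `s > 0` with `d - U < s < Y`. Tonelli and independence
reduce its mean to the integral of P(`Y > s`) · P(`U > d - s`). -/
lemma lintegral_ofReal_exceedance {P : Measure Ω} [IsProbabilityMeasure P] {U Y : Ω → ℝ}
    (hU : Measurable U) (hY : Measurable Y) (hUY : IndepFun U Y P) {lam mu d : ℝ}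
    [hlam : Fact (0 < lam)] [hmu : Fact (0 < mu)] (hd : 0 ≤ d) (hUlaw : P.map U = expMeasure mu)
    (hYlaw : ∀ s, 0 ≤ s → P {ω | s < Y ω} = ENNReal.ofReal (cycleTail lam mu s)) :
    ∫⁻ ω, ENNReal.ofReal (max 0 (Y ω - max 0 (d - U ω))) ∂P =
      ENNReal.ofReal (meanExceedance lam mu d) := by
  rw [← (lintegral_cycleTail_mul_exp_max hlam.out hmu.out hd).2]
  set S : Set (Ω × ℝ) := {p | 0 < p.2 ∧ p.2 < Y p.1 ∧ d - U p.1 < p.2}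
  have hS : MeasurableSet S := by
    change MeasurableSet ({p : Ω × ℝ | 0 < p.2} ∩ ({p | p.2 < Y p.1} ∩ {p | d - U p.1 < p.2}))
    exact (measurableSet_lt (by fun_prop) (by fun_prop)).inter
      ((measurableSet_lt (by fun_prop) (by fun_prop)).inter
        (measurableSet_lt (by fun_prop) (by fun_prop)))
  have h1 : (P.prod volume) S = ∫⁻ ω, ENNReal.ofReal (max 0 (Y ω - max 0 (d - U ω))) ∂P := by
    rw [Measure.prod_apply hS]
    refine lintegral_congr fun ω => ?_
    have : Prod.mk ω ⁻¹' S = Set.Ioo (max 0 (d - U ω)) (Y ω) := by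
      ext s; simp only [S, Set.mem_preimage, Set.mem_ofPred_eq, Set.mem_Ioo, max_lt_iff]; tauto
    rw [this, Real.volume_Ioo, max_comm 0 (Y ω - _), ENNReal.ofReal_max]
    simp
  rw [← h1, Measure.prod_apply_symm hS, ← lintegral_indicator measurableSet_Ioi]
  refine lintegral_congr fun s => ?_
  by_cases hs : 0 < s
  · rw [Set.indicator_of_mem (Set.mem_Ioi.2 hs)]
    have : (fun ω => (ω, s)) ⁻¹' S = U ⁻¹' Set.Ioi (d - s) ∩ Y ⁻¹' Set.Ioi s := by
      ext ω
      simp only [S, Set.mem_preimage, Set.mem_ofPred_eq, Set.mem_inter_iff, Set.mem_Ioi, hs,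
        true_and]
      rw [and_comm]
      refine and_congr_left fun _ => ?_
      constructor <;> intro h <;> linarith
    rw [this, hUY.measure_inter_preimage_eq_mul _ _ measurableSet_Ioi measurableSet_Ioi,
      ← Measure.map_apply hU measurableSet_Ioi, hUlaw, expMeasure_Ioi_max,
      show P (Y ⁻¹' Set.Ioi s) = _ from hYlaw s hs.le,
      ← ENNReal.ofReal_mul (Real.exp_pos _).le, mul_comm]
  · rw [Set.indicator_of_notMem (by simpa using hs)]
    simp [S, hs]

/-! ### Laws of large numbers for the cycles -/

/-- The length of the `k`-th cycle between departures, as a random variable. -/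
noncomputable def cycle (Z X : ℕ → Ω → ℝ) (k : ℕ) (ω : Ω) : ℝ :=
  idlePeriod Z X k ω + X (k + 1) ω

/-- The time spent above `d` in the `k`-th cycle between departures. -/
noncomputable def cycleExceedance (Z X : ℕ → Ω → ℝ) (d : ℝ) (k : ℕ) (ω : Ω) : ℝ :=
  max 0 (cycle Z X k ω - max 0 (d - X k ω))

lemma cycleExceedance_nonneg {Ω : Type*} [MeasurableSpace Ω]
    (Z X : ℕ → Ω → ℝ) (d : ℝ) (k : ℕ) (ω : Ω) :
    0 ≤ cycleExceedance Z X d k ω := le_max_left _ _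

lemma integrable_and_integral_of_map {P : Measure Ω} {U : Ω → ℝ} (hU : Measurable U) {r : ℝ}
    [Fact (0 < r)] (h : P.map U = expMeasure r) : Integrable U P ∧ ∫ ω, U ω ∂P = 1 / r := by
  have hl : HasLaw U (expMeasure r) P := ⟨hU.aemeasurable, h⟩
  refine ⟨?_, ?_⟩
  · exact (MeasurePreserving.mk hU h).integrable_comp_of_integrable (integrable_id_expMeasure r)
  · rw [← integral_id_expMeasure r]
    exact hl.integral_comp aestronglyMeasurable_id

section

variable {P : Measure Ω} {Z X : ℕ → Ω → ℝ} {lam mu : ℝ}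

lemma IsMM11.measurable_cycle (h : IsMM11 P Z X lam mu) (k : ℕ) : Measurable (cycle Z X k) :=
  (h.measurable_idlePeriod k).add (h.measurable_service (k + 1))

lemma IsMM11.measurable_cycleExceedance (h : IsMM11 P Z X lam mu) (d : ℝ) (k : ℕ) :
    Measurable (cycleExceedance Z X d k) :=
  measurable_const.max ((h.measurable_cycle k).sub
    (measurable_const.max (measurable_const.sub (h.measurable_service k))))

variable [hlam : Fact (0 < lam)] [hmu : Fact (0 < mu)]

lemma IsMM11.ae_regular (h : IsMM11 P Z X lam mu) :
    ∀ᵐ ω ∂P, Tendsto (sourceArrival fun n => Z n ω) atTop atTop ∧ (∀ k, 0 < X k ω) ∧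
      0 < Z 0 ω := by
  have hZ := (measurePreserving_fst.comp h.measurePreserving_input)
    |>.quasiMeasurePreserving.tendsto_ae.eventually (ae_tendsto_sourceArrival lam)
  have hX : ∀ k, ∀ᵐ ω ∂P, 0 < X k ω := fun k => ae_of_ae_map
    (h.measurable_service k).aemeasurable (by rw [h.map_service k]; exact ae_pos_expMeasure mu)
  have hZ0 : ∀ᵐ ω ∂P, 0 < Z 0 ω := ae_of_ae_map
    (h.measurable_interarrival 0).aemeasurable
      (by rw [h.map_interarrival 0]; exact ae_pos_expMeasure lam)
  filter_upwards [hZ, ae_all_iff.2 hX, hZ0] with ω h1 h2 h3 using ⟨h1, h2, h3⟩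

lemma IsMM11.interDeparture_ae_eq (h : IsMM11 P Z X lam mu) (k : ℕ) :
    interDeparture Z X (k + 1) =ᵐ[P] cycle Z X k := by
  filter_upwards [h.ae_regular] with ω hω
  rw [interDeparture, Nat.add_sub_cancel, departureTime_succ hω.1, add_sub_cancel_left]
  rfl

lemma IsMM11.g_ae_eq (h : IsMM11 P Z X lam mu) (d : ℝ) (k : ℕ) :
    g Z X d (k + 1) =ᵐ[P] cycleExceedance Z X d k := by
  filter_upwards [h.ae_regular] with ω hω
  rw [g, exceedanceTime_succ hω.1 hω.2.1]
  rfl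

lemma IsMM11.integrable_cycle (h : IsMM11 P Z X lam mu) (k : ℕ) :
    Integrable (cycle Z X k) P :=
  (integrable_and_integral_of_map (h.measurable_idlePeriod k) (h.map_idlePeriod k)).1.add
    (integrable_and_integral_of_map (h.measurable_service _) (h.map_service _)).1

lemma IsMM11.integral_cycle (h : IsMM11 P Z X lam mu) (k : ℕ) :
    ∫ ω, cycle Z X k ω ∂P = 1 / lam + 1 / mu := by
  have h1 := integrable_and_integral_of_map (h.measurable_idlePeriod k) (h.map_idlePeriod k)
  have h2 := integrable_and_integral_of_map (h.measurable_service (k + 1)) (h.map_service (k + 1))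
  rw [← h1.2, ← h2.2]
  exact integral_add h1.1 h2.1

variable [IsProbabilityMeasure P]

lemma IsMM11.indepFun_cycle_service (h : IsMM11 P Z X lam mu) (k : ℕ) :
    IndepFun (fun ω => (idlePeriod Z X k ω, X (k + 1) ω)) (X k) P :=
  h.iIndepFun_idlePeriod.indepFun_prodMk h.measurable_sumElim_idlePeriod (Sum.inl k)
    (Sum.inr (k + 1)) (Sum.inr k) (by simp) (by simp)

/-- The service time before a cycle, the idle period, and the service time in the cycle have the
same joint law for all cycles. -/
lemma IsMM11.measurePreserving_cycle (h : IsMM11 P Z X lam mu) (k : ℕ) :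
    MeasurePreserving (fun ω => (X k ω, (idlePeriod Z X k ω, X (k + 1) ω))) P
      ((expMeasure mu).prod ((expMeasure lam).prod (expMeasure mu))) := by
  have hI := h.measurable_idlePeriod k
  have hX := h.measurable_service
  have h1 : IndepFun (idlePeriod Z X k) (X (k + 1)) P :=
    h.iIndepFun_idlePeriod.indepFun (i := Sum.inl k) (j := Sum.inr (k + 1)) (by simp)
  have h2 := h.indepFun_cycle_service k
  refine ⟨(hX k).prodMk (hI.prodMk (hX _)), ?_⟩
  rw [(indepFun_iff_map_prod_eq_prod_map_map (hX k).aemeasurable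
    (hI.prodMk (hX _)).aemeasurable).1 h2.symm,
    (indepFun_iff_map_prod_eq_prod_map_map hI.aemeasurable (hX _).aemeasurable).1 h1,
    h.map_service, h.map_service, h.map_idlePeriod]

lemma IsMM11.measure_lt_cycle (h : IsMM11 P Z X lam mu) (k : ℕ) {s : ℝ} (hs : 0 ≤ s) :
    P {ω | s < cycle Z X k ω} = ENNReal.ofReal (cycleTail lam mu s) := by
  rw [← expMeasure_prod_lt_add hs,
    ← (measurePreserving_snd.comp (h.measurePreserving_cycle k)).measure_preimage
      (measurableSet_lt (by fun_prop) (by fun_prop)).nullMeasurableSet]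
  rfl

lemma IsMM11.indepFun_service_cycle (h : IsMM11 P Z X lam mu) (k : ℕ) :
    IndepFun (X k) (cycle Z X k) P := by
  exact (h.indepFun_cycle_service k).symm.comp measurable_id (ψ := fun p : ℝ × ℝ => p.1 + p.2) (by fun_prop)

lemma IsMM11.lintegral_cycleExceedance (h : IsMM11 P Z X lam mu) {d : ℝ} (hd : 0 ≤ d) (k : ℕ) :
    ∫⁻ ω, ENNReal.ofReal (cycleExceedance Z X d k ω) ∂P =
      ENNReal.ofReal (meanExceedance lam mu d) :=
  lintegral_ofReal_exceedance (h.measurable_service k) (h.measurable_cycle k)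
    (h.indepFun_service_cycle k) hd (h.map_service k) fun _ hs => h.measure_lt_cycle k hs

lemma IsMM11.integrable_cycleExceedance (h : IsMM11 P Z X lam mu) {d : ℝ} (hd : 0 ≤ d) (k : ℕ) :
    Integrable (cycleExceedance Z X d k) P := by
  refine ⟨(h.measurable_cycleExceedance d k).aestronglyMeasurable, ?_⟩
  rw [hasFiniteIntegral_iff_ofReal (ae_of_all _ fun ω => cycleExceedance_nonneg Z X d k ω),
    h.lintegral_cycleExceedance hd]
  exact ENNReal.ofReal_lt_top

lemma IsMM11.integral_cycleExceedance (h : IsMM11 P Z X lam mu) {d : ℝ} (hd : 0 ≤ d) (k : ℕ) :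
    ∫ ω, cycleExceedance Z X d k ω ∂P = meanExceedance lam mu d := by
  rw [integral_eq_lintegral_of_nonneg_ae (ae_of_all _ fun ω => cycleExceedance_nonneg Z X d k ω)
    (h.measurable_cycleExceedance d k).aestronglyMeasurable, h.lintegral_cycleExceedance hd,
    ENNReal.toReal_ofReal (lintegral_cycleTail_mul_exp_max hlam.out hmu.out hd).1]

/-- Functionals of two cycles that are not adjacent are independent. -/
lemma IsMM11.indepFun_of_cycles (h : IsMM11 P Z X lam mu) {f : ℝ → ℝ → ℝ → ℝ}
    (hf : Measurable fun p : ℝ × ℝ × ℝ => f p.1 p.2.1 p.2.2) {i j : ℕ} (hij : i + 2 ≤ j) :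
    IndepFun (fun ω => f (X i ω) (idlePeriod Z X i ω) (X (i + 1) ω))
      (fun ω => f (X j ω) (idlePeriod Z X j ω) (X (j + 1) ω)) P := by
  classical
  have hm := h.measurable_sumElim_idlePeriod
  -- The inputs of cycle `i`; `Sum.inr (i + 1)` is shared with cycle `i + 1`, hence the gap of two.
  let S : ℕ → Finset (ℕ ⊕ ℕ) := fun i => {Sum.inr i, Sum.inl i, Sum.inr (i + 1)}
  have hdisj : Disjoint (S i) (S j) := by
    rw [Finset.disjoint_left]
    intro a ha hb
    simp only [S, Finset.mem_insert, Finset.mem_singleton] at ha hb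
    rcases ha with rfl | rfl | rfl <;> simp at hb <;> omega
  have hS := h.iIndepFun_idlePeriod.indepFun_finset (S i) (S j) hdisj hm
  have hφ : ∀ i, Measurable fun v : S i → ℝ =>
      f (v ⟨Sum.inr i, by simp [S]⟩) (v ⟨Sum.inl i, by simp [S]⟩)
        (v ⟨Sum.inr (i + 1), by simp [S]⟩) := fun i =>
    hf.comp (f := fun v : S i → ℝ => (v ⟨Sum.inr i, by simp [S]⟩, v ⟨Sum.inl i, by simp [S]⟩,
        v ⟨Sum.inr (i + 1), by simp [S]⟩)) (by fun_prop)
  exact hS.comp (hφ i) (hφ j)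

/-- Even and odd cycles obey the strong law separately, and the two limits add. The sum has `2 * n`
terms but is divided by `n`, whence `2 * m`. -/
lemma IsMM11.tendsto_average_of_cycles (h : IsMM11 P Z X lam mu) {f : ℝ → ℝ → ℝ → ℝ}
    (hf : Measurable fun p : ℝ × ℝ × ℝ => f p.1 p.2.1 p.2.2) {m : ℝ}
    (hint : ∀ k, Integrable (fun ω => f (X k ω) (idlePeriod Z X k ω) (X (k + 1) ω)) P)
    (hm : ∀ k, ∫ ω, f (X k ω) (idlePeriod Z X k ω) (X (k + 1) ω) ∂P = m) :
    ∀ᵐ ω ∂P, Tendsto (fun n : ℕ =>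
      (∑ k ∈ Finset.range (2 * n), f (X k ω) (idlePeriod Z X k ω) (X (k + 1) ω)) / n)
      atTop (𝓝 (2 * m)) := by
  set F : ℕ → Ω → ℝ := fun k ω => f (X k ω) (idlePeriod Z X k ω) (X (k + 1) ω) with hF
  have hid : ∀ i j, IdentDistrib (F i) (F j) P P := fun i j =>
    (IdentDistrib.mk (h.measurePreserving_cycle i).aemeasurable
      (h.measurePreserving_cycle j).aemeasurable ((h.measurePreserving_cycle i).map_eq.trans
        (h.measurePreserving_cycle j).map_eq.symm)).comp hf
  have hind : ∀ a : ℕ, Pairwise (Function.onFun (fun U V => IndepFun U V P)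
      fun i => F (2 * i + a)) := by
    intro a i j hij
    rcases lt_or_gt_of_ne hij with hlt | hlt
    · exact h.indepFun_of_cycles hf (by omega)
    · exact (h.indepFun_of_cycles hf (by omega)).symm
  have hslln := fun a : ℕ => strong_law_ae_real (fun i => F (2 * i + a)) (hint _) (hind a)
    (fun i => hid _ _)
  filter_upwards [hslln 0, hslln 1] with ω h0 h1
  have := h0.add h1
  rw [hm, hm, ← two_mul] at this
  refine this.congr fun n => ?_
  rw [← add_div]
  congr 1
  induction n with
  | zero => simp
  | succ n ih =>
    rw [show 2 * (n + 1) = 2 * n + 1 + 1 by ring, Finset.sum_range_succ, Finset.sum_range_succ,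
      Finset.sum_range_succ, Finset.sum_range_succ, ← ih]
    simp only [add_zero, hF]
    ring

end

/-! ### A renewal-reward argument -/

lemma exists_mem_Ico_of_tendsto {E : ℕ → ℝ} (hEtop : Tendsto E atTop atTop) {T : ℝ} (hT : E 0 ≤ T) :
    ∃ k, T ∈ Set.Ico (E k) (E (k + 1)) := by
  classical
  have hex : ∃ n, T < E n := (hEtop.eventually (eventually_gt_atTop T)).exists
  have hpos : 0 < Nat.find hex := by rw [Nat.find_pos]; exact not_lt.2 hT
  refine ⟨Nat.find hex - 1, not_lt.1 (Nat.find_min hex (Nat.sub_lt hpos one_pos)), ?_⟩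
  rw [Nat.sub_add_cancel (Nat.one_le_of_lt hpos)]
  exact Nat.find_spec hex

/-- For `T` in `[E k, E (k + 1))`, monotonicity puts `M T / T` between `M (E k) / E (k + 1)` and `M
(E (k + 1)) / E k`; both tend to `b / a` because `n / (n + 1)` tends to `1`. -/
lemma tendsto_div_of_tendsto_subsequence {M : ℝ → ℝ} (hM : Monotone M) (hM0 : ∀ T, 0 ≤ M T)
    {E : ℕ → ℝ} (hE : StrictMono E) (hE0 : 0 < E 0) {a b : ℝ} (ha : 0 < a)
    (hEa : Tendsto (fun n : ℕ => E n / n) atTop (𝓝 a))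
    (hMb : Tendsto (fun n : ℕ => M (E n) / n) atTop (𝓝 b)) :
    Tendsto (fun T => M T / T) atTop (𝓝 (b / a)) := by
  have hEpos : ∀ n, 0 < E n := fun n => hE0.trans_le (hE.monotone (Nat.zero_le n))
  have hEtop : Tendsto E atTop atTop := by
    refine (hEa.pos_mul_atTop ha tendsto_natCast_atTop_atTop).congr' ?_
    filter_upwards [eventually_gt_atTop 0] with n hn
    have : (n : ℝ) ≠ 0 := by positivity
    field_simp
  choose! κ hκ using fun T (hT : E 0 ≤ T) => exists_mem_Ico_of_tendsto hEtop hT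
  have hκtop : Tendsto κ atTop atTop := by
    refine tendsto_atTop.2 fun N => ?_
    filter_upwards [eventually_ge_atTop (E N)] with T hT
    have h1 := (hκ T ((hE.monotone (Nat.zero_le N)).trans hT)).2
    exact Nat.lt_succ_iff.1 (hE.lt_iff_lt.1 (hT.trans_lt h1))
  have hcast : Tendsto (fun n : ℕ => (n : ℝ) / (n + 1)) atTop (𝓝 1) :=
    tendsto_natCast_div_add_atTop 1
  have hEa1 : Tendsto (fun n : ℕ => E (n + 1) / (n + 1)) atTop (𝓝 a) := by
    simpa [Function.comp_def] using hEa.comp (tendsto_add_atTop_nat 1)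
  have hMb1 : Tendsto (fun n : ℕ => M (E (n + 1)) / (n + 1)) atTop (𝓝 b) := by
    simpa [Function.comp_def] using hMb.comp (tendsto_add_atTop_nat 1)
  have hlow : Tendsto (fun n : ℕ => M (E n) / E (n + 1)) atTop (𝓝 (b / a)) := by
    have := (hMb.div hEa1 ha.ne').mul hcast
    rw [mul_one] at this
    refine this.congr' ?_
    filter_upwards [eventually_gt_atTop 0] with n hn
    have h1 : (n : ℝ) ≠ 0 := by positivity
    have h2 : (n : ℝ) + 1 ≠ 0 := by positivity
    have h3 := (hEpos (n + 1)).ne'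
    simp only [Pi.div_apply]
    field_simp
  have hup : Tendsto (fun n : ℕ => M (E (n + 1)) / E n) atTop (𝓝 (b / a)) := by
    have := (hMb1.div hEa ha.ne').div hcast one_ne_zero
    rw [div_one] at this
    refine this.congr' ?_
    filter_upwards [eventually_gt_atTop 0] with n hn
    have h1 : (n : ℝ) ≠ 0 := by positivity
    have h2 : (n : ℝ) + 1 ≠ 0 := by positivity
    have h3 := (hEpos n).ne'
    simp only [Pi.div_apply]
    field_simp
  refine tendsto_of_tendsto_of_tendsto_of_le_of_le' (hlow.comp hκtop) (hup.comp hκtop) ?_ ?_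
  · filter_upwards [eventually_ge_atTop (E 0)] with T hT
    exact div_le_div₀ (hM0 T) (hM (hκ T hT).1) (hE0.trans_le hT) (hκ T hT).2.le
  · filter_upwards [eventually_ge_atTop (E 0)] with T hT
    exact div_le_div₀ (hM0 _) (hM (hκ T hT).2.le) (hEpos _) (hκ T hT).1

/-! ### The age over long time intervals -/

section Path

variable {z x : ℕ → ℝ}

lemma tendsto_departureTime (hS : Tendsto (sourceArrival z) atTop atTop) (hx : ∀ k, 0 < x k) :
    Tendsto (departureTime z x) atTop atTop := by
  have hN : StrictMono (servedIndex z x) := strictMono_nat_of_lt_succ fun k => by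
    rw [servedIndex_succ hS]; omega
  refine tendsto_atTop_mono (fun k => ?_) (hS.comp hN.tendsto_atTop)
  exact (lt_add_of_pos_right (arrivalTime z x k) (hx k)).le

/-- Time during `[0, T]` for which the age exceeds `d`. -/
noncomputable def exceedanceMass (z x : ℕ → ℝ) (d T : ℝ) : ℝ :=
  volume.real {t | t ∈ Set.Icc 0 T ∧ d < age z x t}

lemma monotone_exceedanceMass (z x : ℕ → ℝ) (d : ℝ) : Monotone (exceedanceMass z x d) := by
  intro S T hST
  refine measureReal_mono (fun t ht => ⟨⟨ht.1.1, ht.1.2.trans hST⟩, ht.2⟩) ?_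
  exact measure_ne_top_of_subset (fun t ht => ht.1) (measure_Icc_lt_top (a := (0 : ℝ)) (b := T)).ne

lemma exceedanceMass_le (z x : ℕ → ℝ) (d : ℝ) {T : ℝ} (hT : 0 ≤ T) :
    exceedanceMass z x d T ≤ T := by
  calc exceedanceMass z x d T ≤ volume.real (Set.Icc 0 T) :=
        measureReal_mono (fun t ht => ht.1) measure_Icc_lt_top.ne
    _ = T := by rw [Real.volume_real_Icc_of_le hT, sub_zero]

lemma exceedanceMass_departureTime_succ {k : ℕ} (h0 : 0 ≤ departureTime z x k)
    (hk : departureTime z x k ≤ departureTime z x (k + 1)) (d : ℝ) :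
    exceedanceMass z x d (departureTime z x (k + 1)) =
      exceedanceMass z x d (departureTime z x k) + exceedanceTime z x d (k + 1) := by
  set a := departureTime z x k
  set b := departureTime z x (k + 1)
  set A : Set ℝ := {t | t ∈ Set.Icc 0 b ∧ d < age z x t}
  have hA : volume A ≠ ∞ := measure_ne_top_of_subset (fun t ht => ht.1) measure_Icc_lt_top.ne
  have h1 : A ∩ Set.Ico a b = {t | t ∈ Set.Ico (departureTime z x (k + 1 - 1)) b ∧
      d < age z x t} := by
    ext t
    simp only [A, Set.mem_inter_iff, Set.mem_ofPred_eq, Nat.add_sub_cancel]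
    exact ⟨fun h => ⟨h.2, h.1.2⟩, fun h => ⟨⟨⟨h0.trans h.1.1, h.1.2.le⟩, h.2⟩, h.1⟩⟩
  -- The two sets differ at most at the endpoints `a` and `b`.
  have h2 : (A \ Set.Ico a b : Set ℝ) =ᵐ[volume] {t | t ∈ Set.Icc 0 a ∧ d < age z x t} := by
    have hne : ∀ c : ℝ, ∀ᵐ t ∂(volume : Measure ℝ), t ≠ c := fun c => by
      simp [ae_iff]
    filter_upwards [hne a, hne b] with t ha hb
    refine propext ⟨fun h => ⟨⟨h.1.1.1, ?_⟩, h.1.2⟩, fun h => ⟨⟨⟨h.1.1, h.1.2.trans hk⟩, h.2⟩, ?_⟩⟩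
    · by_contra! hlt
      exact h.2 ⟨hlt.le, lt_of_le_of_ne h.1.1.2 hb⟩
    · exact fun h' => ha (le_antisymm h.1.2 h'.1)
  have h3 := measureReal_inter_add_sdiff (s := A) (measurableSet_Ico (a := a) (b := b)) hA
  rw [exceedanceMass, exceedanceMass, exceedanceTime, ← h3, h1, measureReal_congr h2, add_comm]

lemma exceedanceMass_departureTime (hS : Tendsto (sourceArrival z) atTop atTop)
    (hx : ∀ k, 0 < x k) (hz : 0 < z 0) (d : ℝ) (k : ℕ) :
    exceedanceMass z x d (departureTime z x k) = exceedanceMass z x d (departureTime z x 0) +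
      ∑ i ∈ Finset.range k, exceedanceTime z x d (i + 1) := by
  have h0 : 0 < departureTime z x 0 := by
    rw [departureTime_eq_sum hS]; simpa using add_pos hz (hx 0)
  have hmono := (strictMono_departureTime hS hx).monotone
  induction k with
  | zero => simp
  | succ k ih =>
    rw [exceedanceMass_departureTime_succ (h0.le.trans (hmono (Nat.zero_le k)))
      (hmono (Nat.le_succ k)), ih, Finset.sum_range_succ, add_assoc]

end Path

section

variable {P : Measure Ω} {Z X : ℕ → Ω → ℝ} {lam mu : ℝ}

/-- The times and outcomes at which the age exceeds `d`, described through the cycles. -/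
def exceedanceSet (Z X : ℕ → Ω → ℝ) (d : ℝ) : Set (ℝ × Ω) :=
  {p | (p.1 < Z 0 p.2 + X 0 p.2 ∧ d < p.1) ∨
    ∃ k, Z 0 p.2 + X 0 p.2 + ∑ i ∈ Finset.range k, cycle Z X i p.2 ≤ p.1 ∧
      p.1 < Z 0 p.2 + X 0 p.2 + ∑ i ∈ Finset.range (k + 1), cycle Z X i p.2 ∧
      d < p.1 - (Z 0 p.2 + X 0 p.2 + ∑ i ∈ Finset.range k, cycle Z X i p.2) + X k p.2}

/-- Fubini in time and outcome needs joint measurability. It is obtained for this description by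
cycles instead of for the supremum defining the age. -/
lemma IsMM11.measurableSet_exceedanceSet (h : IsMM11 P Z X lam mu) (d : ℝ) :
    MeasurableSet (exceedanceSet Z X d) := by
  have hZ := h.measurable_interarrival
  have hX := h.measurable_service
  have hc := h.measurable_cycle
  have : exceedanceSet Z X d =
      ({p | p.1 < Z 0 p.2 + X 0 p.2} ∩ {p | d < p.1}) ∪
        ⋃ k, {p | Z 0 p.2 + X 0 p.2 + ∑ i ∈ Finset.range k, cycle Z X i p.2 ≤ p.1} ∩
          ({p | p.1 < Z 0 p.2 + X 0 p.2 + ∑ i ∈ Finset.range (k + 1), cycle Z X i p.2} ∩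
          {p | d < p.1 - (Z 0 p.2 + X 0 p.2 + ∑ i ∈ Finset.range k, cycle Z X i p.2) +
            X k p.2}) := by
    ext p
    simp [exceedanceSet]
  rw [this]
  refine ((measurableSet_lt (by fun_prop) (by fun_prop)).inter
    (measurableSet_lt (by fun_prop) (by fun_prop))).union (MeasurableSet.iUnion fun k => ?_)
  exact (measurableSet_le (by fun_prop) (by fun_prop)).inter
    ((measurableSet_lt (by fun_prop) (by fun_prop)).inter
      (measurableSet_lt (by fun_prop) (by fun_prop)))

variable [hlam : Fact (0 < lam)] [hmu : Fact (0 < mu)]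

/-- The exceptional null set does not depend on `t`, so sections can be replaced in both directions.
-/
lemma IsMM11.ae_lt_age_iff (h : IsMM11 P Z X lam mu) (d : ℝ) :
    ∀ᵐ ω ∂P, ∀ t, d < age (fun n => Z n ω) (fun n => X n ω) t ↔ (t, ω) ∈ exceedanceSet Z X d := by
  filter_upwards [h.ae_regular] with ω hω t
  obtain ⟨hS, hx, -⟩ := hω
  have hD : ∀ k, departureTime (fun n => Z n ω) (fun n => X n ω) k =
      Z 0 ω + X 0 ω + ∑ i ∈ Finset.range k, cycle Z X i ω := departureTime_eq_sum hS
  have hD0 := hD 0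
  rw [Finset.sum_range_zero, add_zero] at hD0
  have hmono := strictMono_departureTime hS hx
  simp only [exceedanceSet, Set.mem_ofPred_eq, ← hD]
  rw [← hD0]
  constructor
  · intro hage
    rcases lt_or_ge t (departureTime (fun n => Z n ω) (fun n => X n ω) 0) with ht | ht
    · rw [age_of_lt hS hx ht] at hage
      exact Or.inl ⟨ht, hage⟩
    · obtain ⟨k, hk⟩ := exists_mem_Ico_of_tendsto (tendsto_departureTime hS hx) ht
      rw [age_of_mem_Ico hS hx hk] at hage
      exact Or.inr ⟨k, hk.1, hk.2, hage⟩
  · rintro (⟨ht, hd⟩ | ⟨k, hk1, hk2, hd⟩)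
    · rwa [age_of_lt hS hx ht]
    · rwa [age_of_mem_Ico hS hx ⟨hk1, hk2⟩]

lemma IsMM11.violationProb_eq (h : IsMM11 P Z X lam mu) (d t : ℝ) :
    violationProb P Z X d t = P.real (Prod.mk t ⁻¹' exceedanceSet Z X d) := by
  refine measureReal_congr ?_
  filter_upwards [h.ae_lt_age_iff d] with ω hω
  exact propext (hω t)

lemma IsMM11.exceedanceFraction_ae_eq (h : IsMM11 P Z X lam mu) (d T : ℝ) :
    (fun ω => exceedanceFraction (fun n => Z n ω) (fun n => X n ω) d T) =ᵐ[P]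
      fun ω => (volume.restrict (Set.Icc 0 T)).real
        ((fun t => (t, ω)) ⁻¹' exceedanceSet Z X d) / T := by
  filter_upwards [h.ae_lt_age_iff d] with ω hω
  rw [exceedanceFraction, measureReal_restrict_apply' measurableSet_Icc]
  congr 2
  ext t
  simp only [Set.mem_ofPred_eq, Set.mem_inter_iff, Set.mem_preimage, hω]
  exact and_comm

variable [IsProbabilityMeasure P]

lemma IsMM11.ae_tendsto_exceedanceFraction (h : IsMM11 P Z X lam mu) {d : ℝ} (hd : 0 ≤ d) :
    ∀ᵐ ω ∂P, Tendsto (fun T => exceedanceFraction (fun n => Z n ω) (fun n => X n ω) d T) atTop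
      (𝓝 (meanExceedance lam mu d / (1 / lam + 1 / mu))) := by
  have hc := h.tendsto_average_of_cycles (f := fun _ u v => u + v) (by fun_prop)
    h.integrable_cycle h.integral_cycle
  have he := h.tendsto_average_of_cycles (f := fun x u v => max 0 (u + v - max 0 (d - x)))
    (by fun_prop) (h.integrable_cycleExceedance hd) (h.integral_cycleExceedance hd)
  filter_upwards [h.ae_regular, hc, he] with ω hω hcω heω
  obtain ⟨hS, hx, hz⟩ := hω
  have hmono := strictMono_departureTime hS hx
  have hpos : 0 < 1 / lam + 1 / mu :=
    add_pos (one_div_pos.2 hlam.out) (one_div_pos.2 hmu.out)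
  have hsub : StrictMono fun n : ℕ => 2 * n := fun a b hab => by simpa using hab
  have hconst : ∀ c : ℝ, Tendsto (fun n : ℕ => c / n) atTop (𝓝 0) :=
    tendsto_const_div_atTop_nhds_zero_nat
  -- Averages are known along `2 * n` cycles, so every second departure is used; the factors `2`
  -- cancel in the quotient.
  have key := tendsto_div_of_tendsto_subsequence
    (M := exceedanceMass (fun n => Z n ω) (fun n => X n ω) d)
    (E := fun n => departureTime (fun n => Z n ω) (fun n => X n ω) (2 * n))
    (a := 2 * (1 / lam + 1 / mu)) (b := 2 * meanExceedance lam mu d)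
    (monotone_exceedanceMass _ _ d) (fun T => measureReal_nonneg) (hmono.comp hsub) ?_
    (by positivity) ?_ ?_
  · rw [mul_div_mul_left _ _ two_ne_zero] at key
    exact key
  · rw [departureTime_eq_sum hS]
    simpa using add_pos hz (hx 0)
  · have := (hconst (Z 0 ω + X 0 ω)).add hcω
    rw [zero_add] at this
    refine this.congr fun n => ?_
    rw [departureTime_eq_sum hS, ← add_div]
    rfl
  -- The stretch before the first departure contributes a constant, which vanishes after division by
  -- `n`.
  · have := (hconst (exceedanceMass (fun n => Z n ω) (fun n => X n ω) d
      (departureTime (fun n => Z n ω) (fun n => X n ω) 0))).add heω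
    rw [zero_add] at this
    refine this.congr fun n => ?_
    rw [exceedanceMass_departureTime hS hx hz d (2 * n), ← add_div,
      Finset.sum_congr rfl fun i _ => exceedanceTime_succ hS hx d i]
    rfl

/-! ### Time averages of the violation probability -/

lemma IsMM11.measurable_violationProb (h : IsMM11 P Z X lam mu) (d : ℝ) :
    Measurable (violationProb P Z X d) := by
  rw [show violationProb P Z X d = _ from funext (h.violationProb_eq d)]
  exact (measurable_measure_prodMk_left (h.measurableSet_exceedanceSet d)).ennreal_toReal

/-- Fubini, then rescaling time by `T`: on the fixed interval `[0, 1]` dominated convergence becomes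
available as `T` grows. -/
lemma IsMM11.integral_exceedanceFraction (h : IsMM11 P Z X lam mu) (d : ℝ) {T : ℝ} (hT : 0 < T) :
    ∫ ω, exceedanceFraction (fun n => Z n ω) (fun n => X n ω) d T ∂P =
      ∫ s in (0 : ℝ)..1, violationProb P Z X d (T * s) := by
  have hB := h.measurableSet_exceedanceSet d
  rw [integral_congr_ae (h.exceedanceFraction_ae_eq d T), integral_div,
    intervalIntegral.integral_comp_mul_left _ hT.ne', mul_zero, mul_one, smul_eq_mul,
    intervalIntegral.integral_of_le hT.le, ← integral_Icc_eq_integral_Ioc, inv_mul_eq_div]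
  congr 1
  simp only [h.violationProb_eq, Measure.real]
  rw [integral_toReal (measurable_measure_prodMk_right hB).aemeasurable
    (ae_of_all _ fun ω => measure_lt_top _ _),
    integral_toReal (measurable_measure_prodMk_left hB).aemeasurable
    (ae_of_all _ fun ω => measure_lt_top _ _), ← Measure.prod_apply hB, Measure.prod_apply_symm hB]

lemma IsMM11.tendsto_integral_exceedanceFraction (h : IsMM11 P Z X lam mu) {d : ℝ} (hd : 0 ≤ d) :
    Tendsto (fun T => ∫ ω, exceedanceFraction (fun n => Z n ω) (fun n => X n ω) d T ∂P) atTop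
      (𝓝 (meanExceedance lam mu d / (1 / lam + 1 / mu))) := by
  have hB := h.measurableSet_exceedanceSet d
  have key := tendsto_integral_filter_of_dominated_convergence (μ := P) (l := atTop)
    (F := fun T ω => exceedanceFraction (fun n => Z n ω) (fun n => X n ω) d T)
    (f := fun _ => meanExceedance lam mu d / (1 / lam + 1 / mu)) (fun _ => 1) ?_ ?_
    (integrable_const _) (h.ae_tendsto_exceedanceFraction hd)
  · simpa using key
  · refine Eventually.of_forall fun T => ?_
    refine (Measurable.aestronglyMeasurable ?_).congr (h.exceedanceFraction_ae_eq d T).symm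
    exact ((measurable_measure_prodMk_right hB).ennreal_toReal).div_const T
  · filter_upwards [eventually_gt_atTop 0] with T hT
    refine ae_of_all _ fun ω => ?_
    have h0 : 0 ≤ exceedanceFraction (fun n => Z n ω) (fun n => X n ω) d T :=
      div_nonneg measureReal_nonneg hT.le
    rw [Real.norm_of_nonneg h0]
    exact (div_le_one hT).2 (exceedanceMass_le _ _ d hT.le)

/-- For each `s > 0` the time `T * s` diverges, so the rescaled time average tends to `p`; it also
equals the expected fraction, whose limit is known. -/
lemma IsMM11.eq_of_tendsto_violationProb (h : IsMM11 P Z X lam mu) {d : ℝ} (hd : 0 ≤ d) {p : ℝ}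
    (hp : Tendsto (fun t => violationProb P Z X d t) atTop (𝓝 p)) :
    p = meanExceedance lam mu d / (1 / lam + 1 / mu) := by
  have h1 : Tendsto (fun T => ∫ s in (0 : ℝ)..1, violationProb P Z X d (T * s)) atTop
      (𝓝 (∫ _ in (0 : ℝ)..1, p)) := by
    refine intervalIntegral.tendsto_integral_filter_of_dominated_convergence (fun _ => 1) ?_ ?_
      intervalIntegrable_const ?_
    · exact Eventually.of_forall fun T =>
        ((h.measurable_violationProb d).comp (measurable_const_mul T)).aestronglyMeasurable
    · refine Eventually.of_forall fun T => ae_of_all _ fun s _ => ?_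
      rw [violationProb, Real.norm_of_nonneg measureReal_nonneg]
      exact measureReal_le_one
    · refine ae_of_all _ fun s hs => ?_
      rw [Set.uIoc_of_le zero_le_one] at hs
      exact hp.comp (tendsto_id.atTop_mul_const hs.1)
  rw [intervalIntegral.integral_const, sub_zero, one_smul] at h1
  refine tendsto_nhds_unique h1 ((h.tendsto_integral_exceedanceFraction hd).congr' ?_)
  filter_upwards [eventually_gt_atTop 0] with T hT
  exact h.integral_exceedanceFraction d hT

end

end AoI

theorem mainTheorem5 {Ω : Type*} [MeasurableSpace Ω] (P : Measure Ω) [IsProbabilityMeasure P]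
    (Z X : ℕ → Ω → ℝ) (lam mu d : ℝ) (hlam : 0 < lam) (hmu : 0 < mu) (hd : 0 ≤ d)
    (hMM11 : AoI.IsMM11 P Z X lam mu) (k : ℕ) (hk : 1 ≤ k) :
    Integrable (AoI.interDeparture Z X k) P ∧
    1 / AoI.departureRate P Z X k = 1 / lam + 1 / mu ∧
    Integrable (AoI.g Z X d k) P ∧
    (lam ≠ mu → ∫ ω, AoI.g Z X d k ω ∂P =
      mu ^ 2 * (Real.exp (-lam * d) - Real.exp (-mu * d)) / (lam * (mu - lam) ^ 2) +
        Real.exp (-mu * d) * (1 / lam + 1 / mu - lam * d / (mu - lam))) ∧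
    (lam = mu → ∫ ω, AoI.g Z X d k ω ∂P =
      mu * Real.exp (-mu * d) / 2 * (d + 2 / mu) ^ 2) ∧
    (∀ p : ℝ, Tendsto (fun t => AoI.violationProb P Z X d t) atTop (𝓝 p) →
      p = AoI.departureRate P Z X k * ∫ ω, AoI.g Z X d k ω ∂P) ∧
    (∀ᵐ ω ∂P, Tendsto
      (fun T => AoI.exceedanceFraction (fun n => Z n ω) (fun n => X n ω) d T) atTop
      (𝓝 (AoI.departureRate P Z X k * ∫ ω', AoI.g Z X d k ω' ∂P))) := by
  have : Fact (0 < lam) := ⟨hlam⟩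
  have : Fact (0 < mu) := ⟨hmu⟩
  -- Cycle `j` ends at departure `j + 1`. At `k = 0` the truncated `k - 1` would make the
  -- inter-departure time zero.
  obtain ⟨j, rfl⟩ := Nat.exists_eq_add_of_le' hk
  have hcyc : ∫ ω, AoI.interDeparture Z X (j + 1) ω ∂P = 1 / lam + 1 / mu :=
    (integral_congr_ae (hMM11.interDeparture_ae_eq j)).trans (hMM11.integral_cycle j)
  have hexc : ∫ ω, AoI.g Z X d (j + 1) ω ∂P = AoI.meanExceedance lam mu d :=
    (integral_congr_ae (hMM11.g_ae_eq d j)).trans (hMM11.integral_cycleExceedance hd j)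
  have hlimit : AoI.departureRate P Z X (j + 1) * ∫ ω, AoI.g Z X d (j + 1) ω ∂P =
      AoI.meanExceedance lam mu d / (1 / lam + 1 / mu) := by
    rw [AoI.departureRate, hcyc, hexc, one_div_mul_eq_div]
  refine ⟨(hMM11.integrable_cycle j).congr (hMM11.interDeparture_ae_eq j).symm, ?_,
    (hMM11.integrable_cycleExceedance hd j).congr (hMM11.g_ae_eq d j).symm, ?_, ?_, ?_, ?_⟩
  · rw [AoI.departureRate, hcyc, one_div_one_div]
  · intro hne
    rw [hexc, AoI.meanExceedance, if_neg hne]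
  · intro heq
    rw [hexc, AoI.meanExceedance, if_pos heq]
  · intro p hp
    rw [hlimit]
    exact hMM11.eq_of_tendsto_violationProb hd hp
  · rw [hlimit]
    exact hMM11.ae_tendsto_exceedanceFraction hd
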